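/- Let $N$ be a (Hausdorff, second countable) real-analytic manifold of dimension $n\ge 2$, equipped with a $C^\infty$ Riemannian metric $h$, not assumed complete, and let $\mathcal F$ be a regular analytic foliation of $N$ of constant rank $d\in[1,n-1]$, given by an atlas of analytic charts onto products of open discs of $\mathbb R^d$ and $\mathbb R^{n-d}$ whose changes of coordinates are locally of the form $(x,y)\mapsto(h_1(x,y),h_2(y))$. For $\ell>0$, two points $x,y\in N$ are called $(\mathcal F,\ell)$-related if there is a smooth path $\varphi:[0,1]\to N$ from $x$ to $y$ whose velocity is everywhere tangent to the leaves of $\mathcal F$ and whose length with respect to $h$ is at most $\ell$. A local transverse section at $\bar x\in N$ is an embedded smooth submanifold $S\subset N$ containing $\bar x$, diffeomorphic to an open disc of dimension $n-d$ and transverse to the leaves of $\mathcal F$; $\mathcal L^{n-d}$ denotes Lebesgue measure on $S$ (defined through a parametrization of $S$ by the open disc; measurability and positivity of measure do not depend on the choice). The foliation $\mathcal F$ is called splittable in $(N,h)$ if for every $\bar x\in N$, every local transverse section $S$ at $\bar x$, every $\ell>0$ and every Lebesgue measurable set $E\subset S$ with $\mathcal L^{n-d}(E)>0$, there is a Lebesgue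 measurable set $F\subset E$ with $\mathcal L^{n-d}(F)>0$ such that no two distinct points of $F$ are $(\mathcal F,\ell)$-related. **Proposition.** Every foliation $\mathcal F$ of rank $d=1$ as above is splittable in $(N,h)$. -/

import Mathlib

open Set Metric MeasureTheory Bundle
open scoped Manifold ContDiff Topology ENNReal

/-- The manifold structure of a Euclidean space over itself is the one given by the identity chart;
this makes instance search return that structure directly. -/
instance euclideanChartedSpaceSelf (k : ℕ) :
    ChartedSpace (EuclideanSpace ℝ (Fin k)) (EuclideanSpace ℝ (Fin k)) :=
  chartedSpaceSelf _

/-- An analytic (regular) foliation of rank `d` on a real-analytic manifold `N` of dimension `n`,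
given by an atlas of foliation charts.  Each chart is an analytic diffeomorphism from an open
subset of `N` onto a product of open discs of `ℝ^d` and `ℝ^(n-d)`, and each change of charts is
locally of the form `(x, y) ↦ (h₁ (x, y), h₂ y)`. -/
structure AnalyticFoliation (n d : ℕ) (N : Type*) [TopologicalSpace N]
    [ChartedSpace (EuclideanSpace ℝ (Fin n)) N] where
  /-- The foliation charts. -/
  charts : Set (OpenPartialHomeomorph N
    (EuclideanSpace ℝ (Fin d) × EuclideanSpace ℝ (Fin (n - d))))
  /-- The foliation charts cover `N`. -/
  exists_chart : ∀ z : N, ∃ e ∈ charts, z ∈ e.source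
  /-- The image of a foliation chart is a product of two open discs. -/
  target_eq : ∀ e ∈ charts, ∃ (a : EuclideanSpace ℝ (Fin d)) (r : ℝ)
    (b : EuclideanSpace ℝ (Fin (n - d))) (s : ℝ),
      0 < r ∧ 0 < s ∧ e.target = ball a r ×ˢ ball b s
  /-- Foliation charts are analytic. -/
  contMDiffOn : ∀ e ∈ charts, ContMDiffOn (𝓡 n)
    𝓘(ℝ, EuclideanSpace ℝ (Fin d) × EuclideanSpace ℝ (Fin (n - d))) ω e e.source
  /-- Inverses of foliation charts are analytic. -/
  contMDiffOn_symm : ∀ e ∈ charts, ContMDiffOn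
    𝓘(ℝ, EuclideanSpace ℝ (Fin d) × EuclideanSpace ℝ (Fin (n - d))) (𝓡 n) ω e.symm e.target
  /-- Changes of charts preserve the plaques: locally, the transverse coordinate in one chart is a
  function of the transverse coordinate in the other chart alone. -/
  compatible : ∀ e ∈ charts, ∀ e' ∈ charts, ∀ z ∈ e.source ∩ e'.source,
    ∃ h₂ : EuclideanSpace ℝ (Fin (n - d)) → EuclideanSpace ℝ (Fin (n - d)),
      ∀ᶠ w in 𝓝 z, (e' w).2 = h₂ (e w).2

namespace AnalyticFoliation

variable {n d : ℕ} {N : Type*} [TopologicalSpace N] [ChartedSpace (EuclideanSpace ℝ (Fin n)) N]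

/-- The tangent space at `x` to the leaf through `x`: the tangent vectors whose transverse component
vanishes in the foliation charts around `x` (by compatibility of the charts, this condition is the
same for all of them). -/
noncomputable def tangentSpace (F : AnalyticFoliation n d N) (x : N) :
    Submodule ℝ (TangentSpace (𝓡 n) x) where
  carrier := {v | ∀ e ∈ F.charts, x ∈ e.source →
    (mfderiv (𝓡 n) 𝓘(ℝ, EuclideanSpace ℝ (Fin d) × EuclideanSpace ℝ (Fin (n - d))) e x v :
      EuclideanSpace ℝ (Fin d) × EuclideanSpace ℝ (Fin (n - d))).2 = 0}
  add_mem' := by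
    intro v w hv hw e he hx
    rw [map_add]
    exact (congrArg₂ (· + ·) (hv e he hx) (hw e he hx)).trans (add_zero _)
  zero_mem' := by
    intro e _ _
    rw [map_zero]
    rfl
  smul_mem' := by
    intro c v hv e he hx
    rw [map_smul]
    exact (congrArg (c • ·) (hv e he hx)).trans (smul_zero c)

/-- A smooth path `γ : [0,1] → N` (only the values on `[0,1]` matter) is horizontal if its velocity
is everywhere tangent to the foliation. -/
def IsHorizontal (F : AnalyticFoliation n d N) (γ : ℝ → N) : Prop :=
  ∀ t ∈ Icc (0 : ℝ) 1,
    (mfderivWithin 𝓘(ℝ, ℝ) (𝓡 n) γ (Icc 0 1) t (1 : ℝ) : TangentSpace (𝓡 n) (γ t)) ∈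
      F.tangentSpace (γ t)

/-- Two points are `(F, ℓ)`-related if a smooth horizontal path `[0,1] → N` of length at most `ℓ`
joins the first to the second. -/
def Related [IsManifold (𝓡 n) ω N] [RiemannianBundle (fun x : N ↦ TangentSpace (𝓡 n) x)]
    (F : AnalyticFoliation n d N) (ℓ : ℝ) (x y : N) : Prop :=
  ∃ γ : ℝ → N, ContMDiffOn 𝓘(ℝ, ℝ) (𝓡 n) ∞ γ (Icc 0 1) ∧ F.IsHorizontal γ ∧
    Manifold.pathELength (𝓡 n) γ 0 1 ≤ ENNReal.ofReal ℓ ∧ γ 0 = x ∧ γ 1 = y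

/-- A local transverse section at `p`, together with a parametrization by the open unit disc: an
embedded smooth submanifold of `N` through `p`, diffeomorphic to the open disc of dimension `n - d`
and transverse to the leaves. -/
structure TransverseSection (F : AnalyticFoliation n d N) (p : N) where
  /-- The parametrization (only its values on the open unit disc matter). -/
  param : EuclideanSpace ℝ (Fin (n - d)) → N
  /-- The parametrization is smooth. -/
  contMDiffOn : ContMDiffOn (𝓡 (n - d)) (𝓡 n) ∞ param (ball 0 1)
  /-- The parametrization is an immersion. -/
  injective_mfderiv : ∀ u ∈ ball (0 : EuclideanSpace ℝ (Fin (n - d))) 1,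
    Function.Injective (mfderiv (𝓡 (n - d)) (𝓡 n) param u)
  /-- The parametrization is a homeomorphism onto its image. -/
  isEmbedding : Topology.IsEmbedding
    ((ball (0 : EuclideanSpace ℝ (Fin (n - d))) 1).domRestrict param)
  /-- The section is transverse to the leaves. -/
  transverse : ∀ u ∈ ball (0 : EuclideanSpace ℝ (Fin (n - d))) 1,
    (mfderiv (𝓡 (n - d)) (𝓡 n) param u).range ⊔ F.tangentSpace (param u) = ⊤
  /-- The section passes through `p`. -/
  mem_image : p ∈ param '' ball 0 1

namespace TransverseSection

variable {F : AnalyticFoliation n d N} {p : N}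

/-- The underlying set of a local transverse section. -/
def carrier (S : F.TransverseSection p) : Set N := S.param '' ball 0 1

/-- The trace of `A` on the section, read in the parametrizing disc. -/
def preimage (S : F.TransverseSection p) (A : Set N) : Set (EuclideanSpace ℝ (Fin (n - d))) :=
  ball 0 1 ∩ S.param ⁻¹' A

/-- Lebesgue measurability in the section, i.e. measurability for the completed measure. -/
def LebesgueMeasurable (S : F.TransverseSection p) (A : Set N) : Prop :=
  NullMeasurableSet (S.preimage A) volume

/-- The Lebesgue measure on the section, read in the parametrization.  Another parametrization
changes it by a positive smooth density, hence has the same measurable sets and the same null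
sets. -/
noncomputable def lebesgue (S : F.TransverseSection p) (A : Set N) : ℝ≥0∞ :=
  volume (S.preimage A)

end TransverseSection

/-- The foliation is splittable (for the given Riemannian metric) if, for all `ℓ > 0`, every
measurable set of positive Lebesgue measure in a local transverse section contains a measurable set
of positive Lebesgue measure no two distinct points of which are `(F, ℓ)`-related. -/
def IsSplittable [IsManifold (𝓡 n) ω N] [RiemannianBundle (fun x : N ↦ TangentSpace (𝓡 n) x)]
    (F : AnalyticFoliation n d N) : Prop :=
  ∀ (p : N) (S : F.TransverseSection p) (ℓ : ℝ), 0 < ℓ →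
    ∀ A ⊆ S.carrier, S.LebesgueMeasurable A → 0 < S.lebesgue A →
      ∃ B ⊆ A, S.LebesgueMeasurable B ∧ 0 < S.lebesgue B ∧
        ∀ x ∈ B, ∀ y ∈ B, x ≠ y → ¬ F.Related ℓ x y

end AnalyticFoliation

/-! Each leaf is one-dimensional, so within a leaf length leaves almost no freedom: an arc that
never turns back is determined by its starting point, its initial direction and its length. Hence a
point has only finitely many `(F, ℓ)`-related points on a small enough transversal around it.
Completeness plays no role, since only arcs that exist are counted.

To make this precise, the first coordinate of each foliation chart is replaced by Riemannian length
along the plaques (`exists_isLengthChart`). Changes of charts are then, on plaques, of the form `s ↦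
c ± s` locally (`IsLengthChart.compatible`), which is the structure `LineAtlas`. A horizontal path
is cut into pieces lying in charts and becomes a chain of plaque segments that is no longer
(`Related.exists_chain`). Cancelling backtracking turns a chain into an arc that is no longer
(`ArcJoins.step`); arcs are unique (`IsArc.eqOn`), and finiteness follows by pigeonhole
(`finite_arcJoins`).

Measure theory finishes (`exists_forall_not_chain`). By finiteness every point `u` of a compact set
`K` has a radius within which no other point is related to it. The points for which the radius `1 /
(m + 1)` works form a measurable set, because chains with a fixed itinerary form a compact set and
there are countably many itineraries. One of these sets has positive measure, and so has its trace
on some ball of half that radius; no two distinct points of the trace are related. -/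

/-! ### Line atlases and unit speed arcs -/

/-- An atlas of charts onto open subsets of `ℝ × V` whose plaques `V = const` are intervals and
whose changes of charts preserve, locally, the plaques and the length of the first coordinate on
them. -/
structure LineAtlas (N V ι : Type*) [TopologicalSpace N] [TopologicalSpace V] where
  /-- The charts. -/
  chart : ι → OpenPartialHomeomorph N (ℝ × V)
  /-- Compact subsets of the domains of the charts. -/
  core : ι → Set N
  isCompact_core : ∀ i, IsCompact (core i)
  core_subset : ∀ i, core i ⊆ (chart i).source
  exists_core_mem_nhds : ∀ z, ∃ i, core i ∈ 𝓝 z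
  ordConnected : ∀ i v, OrdConnected {s | (s, v) ∈ (chart i).target}
  compatible : ∀ i j z, z ∈ (chart i).source → z ∈ (chart j).source →
    ∃ ε : ℝ, (ε = 1 ∨ ε = -1) ∧ ∀ᶠ w in 𝓝 z, (chart i w).2 = (chart i z).2 →
      (chart j w).2 = (chart j z).2 ∧
        (chart j w).1 = (chart j z).1 + ε * ((chart i w).1 - (chart i z).1)

namespace LineAtlas

variable {N V ι : Type*} [TopologicalSpace N] [TopologicalSpace V] (A : LineAtlas N V ι)

lemma exists_mem_source (z : N) : ∃ i, z ∈ (A.chart i).source := by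
  obtain ⟨i, hi⟩ := A.exists_core_mem_nhds z
  exact ⟨i, A.core_subset i (mem_of_mem_nhds hi)⟩

lemma eq_of_chart_eq {i : ι} {z w : N} (hz : z ∈ (A.chart i).source) (hw : w ∈ (A.chart i).source)
    (h₁ : (A.chart i z).1 = (A.chart i w).1) (h₂ : (A.chart i z).2 = (A.chart i w).2) : z = w :=
  (A.chart i).injOn hz hw (Prod.ext h₁ h₂)

/-- Near `t` in `I`, the path `σ` moves along a plaque of the chart `i` with velocity `ε`. -/
def HasDirAt (σ : ℝ → N) (I : Set ℝ) (t : ℝ) (i : ι) (ε : ℝ) : Prop :=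
  ∀ᶠ s in 𝓝[I] t, σ s ∈ (A.chart i).source ∧ (A.chart i (σ s)).2 = (A.chart i (σ t)).2 ∧
    (A.chart i (σ s)).1 = (A.chart i (σ t)).1 + ε * (s - t)

/-- The path `σ` runs on `I` along the leaves at unit speed, without turning back. -/
def IsArc (σ : ℝ → N) (I : Set ℝ) : Prop :=
  ∀ t ∈ I, ∀ i, σ t ∈ (A.chart i).source → ∃ ε : ℝ, (ε = 1 ∨ ε = -1) ∧ A.HasDirAt σ I t i ε

variable {A} {σ τ : ℝ → N} {I J : Set ℝ} {t : ℝ} {i j : ι} {ε : ℝ}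

lemma HasDirAt.mono (h : A.HasDirAt σ I t i ε) (hJ : J ⊆ I) : A.HasDirAt σ J t i ε :=
  nhdsWithin_mono t hJ h

lemma HasDirAt.continuousWithinAt (h : A.HasDirAt σ I t i ε) (ht : σ t ∈ (A.chart i).source) :
    ContinuousWithinAt σ I t := by
  have h₁ : ContinuousAt (fun s : ℝ ↦ (A.chart i).symm
      ((A.chart i (σ t)).1 + ε * (s - t), (A.chart i (σ t)).2)) t := by
    apply ContinuousAt.comp (g := (A.chart i).symm)
    · apply (A.chart i).continuousAt_symm
      simpa using (A.chart i).map_source ht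
    · fun_prop
  have h₂ : ContinuousWithinAt _ I t := h₁.continuousWithinAt
  apply h₂.congr_of_eventuallyEq
  · filter_upwards [h] with s hs
    rw [← hs.2.2, ← hs.2.1]
    exact ((A.chart i).left_inv hs.1).symm
  · simp [(A.chart i).left_inv ht]

/-- A direction makes the path continuous, so it stays where the change of charts is a signed
translation on the plaque. Being an arc can thus be tested in one chart around each time. -/
lemma HasDirAt.change (h : A.HasDirAt σ I t i ε) (hε : ε = 1 ∨ ε = -1)
    (hi : σ t ∈ (A.chart i).source) (hj : σ t ∈ (A.chart j).source) :
    ∃ ε' : ℝ, (ε' = 1 ∨ ε' = -1) ∧ A.HasDirAt σ I t j ε' := by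
  obtain ⟨δ, hδ, hc⟩ := A.compatible i j _ hi hj
  have hcont := h.continuousWithinAt hi
  refine ⟨δ * ε, ?_, ?_⟩
  · rcases hε with rfl | rfl <;> rcases hδ with rfl | rfl <;> simp
  · filter_upwards [h, hcont.eventually hc,
      hcont.eventually ((A.chart j).open_source.mem_nhds hj)] with s hs hs' hs''
    obtain ⟨h₁, h₂⟩ := hs' hs.2.1
    refine ⟨hs'', h₁, ?_⟩
    rw [h₂, hs.2.2]
    ring

lemma isArc_of_exists (h : ∀ t ∈ I, ∃ i ε, σ t ∈ (A.chart i).source ∧ (ε = 1 ∨ ε = -1) ∧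
    A.HasDirAt σ I t i ε) : A.IsArc σ I := by
  intro t ht j hj
  obtain ⟨i, ε, hi, hε, hd⟩ := h t ht
  exact hd.change hε hi hj

lemma IsArc.mono (h : A.IsArc σ I) (hJ : J ⊆ I) : A.IsArc σ J := by
  intro t ht i hi
  obtain ⟨ε, hε, hd⟩ := h t (hJ ht) i hi
  exact ⟨ε, hε, hd.mono hJ⟩

lemma IsArc.continuousOn (h : A.IsArc σ I) : ContinuousOn σ I := by
  intro t ht
  obtain ⟨i, hi⟩ := A.exists_mem_source (σ t)
  obtain ⟨ε, -, hd⟩ := h t ht i hi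
  exact hd.continuousWithinAt hi

lemma HasDirAt.comp_affine {c δ : ℝ} (h : A.HasDirAt σ I (c + δ * t) i ε)
    (hJ : MapsTo (fun s ↦ c + δ * s) J I) :
    A.HasDirAt (fun s ↦ σ (c + δ * s)) J t i (ε * δ) := by
  have hc : ContinuousWithinAt (fun s : ℝ ↦ c + δ * s) J t := by fun_prop
  filter_upwards [(hc.tendsto_nhdsWithin hJ).eventually h] with s hs
  refine ⟨hs.1, hs.2.1, ?_⟩
  rw [hs.2.2]
  ring

lemma IsArc.comp_affine {c δ : ℝ} (hδ : δ = 1 ∨ δ = -1) (h : A.IsArc σ I)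
    (hJ : MapsTo (fun s ↦ c + δ * s) J I) : A.IsArc (fun s ↦ σ (c + δ * s)) J := by
  intro t ht i hi
  obtain ⟨ε, hε, hd⟩ := h _ (hJ ht) i hi
  refine ⟨ε * δ, ?_, hd.comp_affine hJ⟩
  rcases hε with rfl | rfl <;> rcases hδ with rfl | rfl <;> simp

/-- The path that starts at `z` and moves along its plaque in the chart `i` with velocity `ε`. -/
noncomputable def line (A : LineAtlas N V ι) (i : ι) (z : N) (ε t : ℝ) : N :=
  (A.chart i).symm ((A.chart i z).1 + ε * t, (A.chart i z).2)

lemma line_zero {z : N} (hz : z ∈ (A.chart i).source) : A.line i z ε 0 = z := by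
  simp [line, (A.chart i).left_inv hz]

lemma line_eq {z w : N} {p : ℝ} (hw : w ∈ (A.chart i).source)
    (h₁ : (A.chart i w).1 = (A.chart i z).1 + ε * p)
    (h₂ : (A.chart i w).2 = (A.chart i z).2) : A.line i z ε p = w := by
  rw [line, ← h₁, ← h₂, Prod.mk.eta, (A.chart i).left_inv hw]

lemma chart_line {z : N} (ht : ((A.chart i z).1 + ε * t, (A.chart i z).2) ∈ (A.chart i).target) :
    A.chart i (A.line i z ε t) = ((A.chart i z).1 + ε * t, (A.chart i z).2) :=
  (A.chart i).right_inv ht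

lemma hasDirAt_line {z : N}
    (hI : ∀ s ∈ I, ((A.chart i z).1 + ε * s, (A.chart i z).2) ∈ (A.chart i).target) (ht : t ∈ I) :
    A.HasDirAt (A.line i z ε) I t i ε := by
  filter_upwards [self_mem_nhdsWithin] with s hs
  rw [chart_line (hI s hs), chart_line (hI t ht)]
  refine ⟨(A.chart i).map_target (hI s hs), rfl, ?_⟩
  ring

lemma isArc_line {z : N} (hε : ε = 1 ∨ ε = -1)
    (hI : ∀ s ∈ I, ((A.chart i z).1 + ε * s, (A.chart i z).2) ∈ (A.chart i).target) :
    A.IsArc (A.line i z ε) I :=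
  isArc_of_exists fun t ht ↦
    ⟨i, ε, (A.chart i).map_target (hI t ht), hε, hasDirAt_line hI ht⟩

/-- Two arcs with the same start and the same initial direction agree. -/
lemma IsArc.eqOn [T2Space N] {b : ℝ} (hσ : A.IsArc σ (Icc 0 b)) (hτ : A.IsArc τ (Icc 0 b))
    (h₀ : σ 0 = τ 0) (hσd : A.HasDirAt σ (Icc 0 b) 0 i ε)
    (hτd : A.HasDirAt τ (Icc 0 b) 0 i ε) : EqOn σ τ (Icc 0 b) := by
  by_contra hne
  obtain ⟨d, hd, hdne⟩ : ∃ d ∈ Icc 0 b, σ d ≠ τ d := by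
    simpa [EqOn, and_assoc] using hne
  set D : Set ℝ := {t ∈ Icc 0 b | σ t ≠ τ t} with hD
  have hDne : D.Nonempty := ⟨d, hd, hdne⟩
  have hDb : BddBelow D := ⟨0, fun t ht ↦ ht.1.1⟩
  set t₀ := sInf D with ht₀
  have h0 : 0 ≤ t₀ := le_csInf hDne fun t ht ↦ ht.1.1
  have htb : t₀ ≤ b := (csInf_le hDb ⟨hd, hdne⟩).trans hd.2
  have hmem : t₀ ∈ Icc 0 b := ⟨h0, htb⟩
  have hlt : ∀ s ∈ Ico 0 t₀, σ s = τ s := by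
    intro s hs
    by_contra hs'
    exact absurd (csInf_le hDb (show s ∈ D from ⟨⟨hs.1, hs.2.le.trans htb⟩, hs'⟩)) (not_le.2 hs.2)
  have hsub : Ico 0 t₀ ⊆ Icc 0 b := fun s hs ↦ ⟨hs.1, hs.2.le.trans htb⟩
  -- At the first time of disagreement the arcs share position and velocity: by hypothesis if `t₀ =
  -- 0`, otherwise by continuity, the velocity being read just to the left of `t₀`.
  have key : ∃ j δ, σ t₀ = τ t₀ ∧ A.HasDirAt σ (Icc 0 b) t₀ j δ ∧
      A.HasDirAt τ (Icc 0 b) t₀ j δ := by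
    rcases h0.eq_or_lt with h | h
    · rw [← h]
      exact ⟨i, ε, h₀, hσd, hτd⟩
    have hbot : (𝓝[Ico 0 t₀] t₀).NeBot := by
      rw [← mem_closure_iff_nhdsWithin_neBot, closure_Ico h.ne]
      exact right_mem_Icc.2 h0
    have heq : σ t₀ = τ t₀ := by
      refine tendsto_nhds_unique (((hσ.continuousOn t₀ hmem).mono hsub).tendsto) ?_
      refine (((hτ.continuousOn t₀ hmem).mono hsub).tendsto).congr' ?_
      filter_upwards [self_mem_nhdsWithin] with s hs using (hlt s hs).symm
    obtain ⟨j, hj⟩ := A.exists_mem_source (σ t₀)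
    obtain ⟨δ, -, h₁⟩ := hσ t₀ hmem j hj
    obtain ⟨δ', -, h₂⟩ := hτ t₀ hmem j (heq ▸ hj)
    obtain ⟨s, ⟨hs₁, hs₂⟩, hs⟩ :=
      (((h₁.mono hsub).and (h₂.mono hsub)).and self_mem_nhdsWithin).exists
    have : δ = δ' := by
      have h₃ := hs₁.2.2
      rw [hlt s hs, hs₂.2.2, heq] at h₃
      exact (mul_right_cancel₀ (sub_ne_zero.2 hs.2.ne) (by linarith)).symm
    exact ⟨j, δ, heq, h₁, this ▸ h₂⟩
  obtain ⟨j, δ, heq, h₁, h₂⟩ := key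
  have hev : ∀ᶠ s in 𝓝[Icc 0 b] t₀, σ s = τ s := by
    filter_upwards [h₁, h₂] with s hs hs'
    refine A.eq_of_chart_eq hs.1 hs'.1 ?_ ?_
    · rw [hs.2.2, hs'.2.2, heq]
    · rw [hs.2.1, hs'.2.1, heq]
  obtain ⟨r, hr, hball⟩ := Metric.mem_nhdsWithin_iff.1 hev
  obtain ⟨s, hs, hsr⟩ := exists_lt_of_csInf_lt hDne (show sInf D < t₀ + r by linarith)
  refine hs.2 (hball ⟨?_, hs.1⟩)
  rw [Metric.mem_ball, Real.dist_eq, abs_lt]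
  have := csInf_le hDb hs
  constructor <;> linarith

/-- Concatenation of arcs. -/
lemma IsArc.concat {b c : ℝ} (hb : 0 ≤ b) (hc : b ≤ c) (hσ : A.IsArc σ (Icc 0 b))
    (hτ : A.IsArc τ (Icc b c)) (h : σ b = τ b) (hi : σ b ∈ (A.chart i).source)
    (hε : ε = 1 ∨ ε = -1) (hσd : A.HasDirAt σ (Icc 0 b) b i ε)
    (hτd : A.HasDirAt τ (Icc b c) b i ε) :
    A.IsArc (fun t ↦ if t ≤ b then σ t else τ t) (Icc 0 c) := by
  set ρ : ℝ → N := fun t ↦ if t ≤ b then σ t else τ t with hρ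
  have h₁ : ∀ t, t ≤ b → ρ t = σ t := fun t ht ↦ if_pos ht
  have h₂ : ∀ t, b ≤ t → ρ t = τ t := by
    intro t ht
    rcases ht.eq_or_lt with rfl | ht
    · rw [h₁ _ le_rfl, h]
    · exact if_neg (not_le.2 ht)
  have hcongr : ∀ {σ' : ℝ → N} {I' : Set ℝ} {t : ℝ} {j : ι} {δ : ℝ}, (∀ s ∈ I', ρ s = σ' s) →
      t ∈ I' → A.HasDirAt σ' I' t j δ → A.HasDirAt ρ I' t j δ := by
    intro σ' I' t j δ hI ht hd
    filter_upwards [hd, self_mem_nhdsWithin] with s hs hs'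
    rwa [hI s hs', hI t ht]
  apply isArc_of_exists
  intro t ht
  rcases lt_trichotomy t b with htb | rfl | htb
  · have hmem : t ∈ Icc 0 b := ⟨ht.1, htb.le⟩
    obtain ⟨j, hj⟩ := A.exists_mem_source (σ t)
    obtain ⟨δ, hδ, hd⟩ := hσ t hmem j hj
    refine ⟨j, δ, by rwa [h₁ t htb.le], hδ, ?_⟩
    have hd' := hcongr (fun s hs ↦ h₁ s hs.2) hmem hd
    refine Filter.Eventually.filter_mono ?_ hd'
    refine nhdsWithin_le_iff.2 ?_
    filter_upwards [self_mem_nhdsWithin, mem_nhdsWithin_of_mem_nhds (Iio_mem_nhds htb)] with s hs hs'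
    exact ⟨hs.1, le_of_lt hs'⟩
  · refine ⟨i, ε, by rwa [h₁ t le_rfl], hε, ?_⟩
    rw [HasDirAt, ← Icc_union_Icc_eq_Icc hb hc, nhdsWithin_union, Filter.eventually_sup]
    exact ⟨hcongr (fun s hs ↦ h₁ s hs.2) (right_mem_Icc.2 hb) hσd,
      hcongr (fun s hs ↦ h₂ s hs.1) (left_mem_Icc.2 hc) hτd⟩
  · have hmem : t ∈ Icc b c := ⟨htb.le, ht.2⟩
    obtain ⟨j, hj⟩ := A.exists_mem_source (τ t)
    obtain ⟨δ, hδ, hd⟩ := hτ t hmem j hj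
    refine ⟨j, δ, by rwa [h₂ t htb.le], hδ, ?_⟩
    have hd' := hcongr (fun s hs ↦ h₂ s hs.1) hmem hd
    refine Filter.Eventually.filter_mono ?_ hd'
    refine nhdsWithin_le_iff.2 ?_
    filter_upwards [self_mem_nhdsWithin, mem_nhdsWithin_of_mem_nhds (Ioi_mem_nhds htb)] with s hs hs'
    exact ⟨le_of_lt hs', hs.2⟩

/-- An arc of length `b` joins `x` to `y`. -/
def ArcJoins (A : LineAtlas N V ι) (x : N) (b : ℝ) (y : N) : Prop :=
  0 ≤ b ∧ ∃ σ : ℝ → N, A.IsArc σ (Icc 0 b) ∧ σ 0 = x ∧ σ b = y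

lemma arcJoins_refl (x : N) : A.ArcJoins x 0 x := by
  obtain ⟨i, hi⟩ := A.exists_mem_source x
  refine ⟨le_rfl, A.line i x 1, isArc_line (Or.inl rfl) ?_, line_zero hi, line_zero hi⟩
  intro s hs
  rw [Icc_self, mem_singleton_iff] at hs
  simpa [hs] using (A.chart i).map_source hi

/-- Plaques are intervals, so the segment between two points of a plaque stays in the chart. -/
lemma add_mul_mem_target {z w : N} {p : ℝ} (hz : z ∈ (A.chart i).source)
    (hw : w ∈ (A.chart i).source) (h₂ : (A.chart i w).2 = (A.chart i z).2)
    (hε : ε = 1 ∨ ε = -1) (hp : (A.chart i w).1 = (A.chart i z).1 + ε * p) (ht : t ∈ Icc 0 p) :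
    ((A.chart i z).1 + ε * t, (A.chart i z).2) ∈ (A.chart i).target := by
  have hz' : (A.chart i z).1 ∈ {s | (s, (A.chart i z).2) ∈ (A.chart i).target} :=
    (A.chart i).map_source hz
  have hw' : (A.chart i w).1 ∈ {s | (s, (A.chart i z).2) ∈ (A.chart i).target} := by
    rw [← h₂]
    exact (A.chart i).map_source hw
  rw [hp] at hw'
  apply (A.ordConnected i (A.chart i z).2).uIcc_subset hz' hw'
  rw [mem_uIcc]
  rcases hε with rfl | rfl
  · left
    constructor <;> linarith [ht.1, ht.2]
  · right
    constructor <;> linarith [ht.1, ht.2]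

/-- Moving the end of an arc inside a plaque. -/
lemma ArcJoins.step [T2Space N] {x z w : N} {b : ℝ} (h : A.ArcJoins x b z)
    (hz : z ∈ (A.chart i).source) (hw : w ∈ (A.chart i).source)
    (h₂ : (A.chart i w).2 = (A.chart i z).2) :
    ∃ b' ≤ b + |(A.chart i w).1 - (A.chart i z).1|, A.ArcJoins x b' w := by
  obtain ⟨hb, σ, hσ, rfl, hσb⟩ := h
  set p := |(A.chart i w).1 - (A.chart i z).1| with hp
  have hp0 : 0 ≤ p := abs_nonneg _
  obtain ⟨ε, hε, hεp⟩ : ∃ ε : ℝ, (ε = 1 ∨ ε = -1) ∧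
      (A.chart i w).1 = (A.chart i z).1 + ε * p := by
    rcases abs_choice ((A.chart i w).1 - (A.chart i z).1) with h | h
    · exact ⟨1, Or.inl rfl, by rw [hp, h]; ring⟩
    · exact ⟨-1, Or.inr rfl, by rw [hp, h]; ring⟩
  have htgt : ∀ t ∈ Icc 0 p, ((A.chart i z).1 + ε * t, (A.chart i z).2) ∈ (A.chart i).target :=
    fun t ht ↦ add_mul_mem_target hz hw h₂ hε hεp ht
  have hτ : A.IsArc (A.line i z ε) (Icc 0 p) := isArc_line hε htgt
  have hτd : A.HasDirAt (A.line i z ε) (Icc 0 p) 0 i ε := hasDirAt_line htgt (left_mem_Icc.2 hp0)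
  have hτp : A.line i z ε p = w := line_eq hw hεp h₂
  obtain ⟨δ, hδ, hσd⟩ := hσ b (right_mem_Icc.2 hb) i (hσb ▸ hz)
  -- If the arc reaches `z` already heading towards `w`, it is prolonged by the plaque segment.
  by_cases hδε : δ = ε
  · subst hδε
    have hmap : MapsTo (fun s : ℝ ↦ -b + 1 * s) (Icc b (b + p)) (Icc 0 p) := by
      intro s hs
      constructor <;> linarith [hs.1, hs.2]
    have hd : A.HasDirAt (fun s ↦ A.line i z δ (-b + 1 * s)) (Icc b (b + p)) b i (δ * 1) :=
      HasDirAt.comp_affine (by rwa [show -b + 1 * b = 0 by ring]) hmap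
    rw [mul_one] at hd
    have harc := hσ.concat hb (le_add_of_nonneg_right hp0) (hτ.comp_affine (Or.inl rfl) hmap)
      (by rw [show -b + 1 * b = 0 by ring, line_zero hz, hσb]) (hσb ▸ hz) hδ hσd hd
    refine ⟨b + p, le_rfl, by positivity, _, harc, by simp [hb], ?_⟩
    by_cases hp' : p = 0
    · have : w = z := by rw [← hτp, hp', line_zero hz]
      simp [hp', hσb, this]
    · have : ¬ (b + p ≤ b) := by
        have := lt_of_le_of_ne hp0 (Ne.symm hp')
        linarith
      simp only [this, if_false]
      rw [show -b + 1 * (b + p) = p by ring, hτp]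
  -- Otherwise the arc came from the side of `w`: run backwards from `z`, it coincides with the
  -- plaque segment for time `min b p`.
  · have hδε' : δ * -1 = ε := by
      rcases hδ with rfl | rfl <;> rcases hε with rfl | rfl <;> first | exact absurd rfl hδε | simp
    have hmap : MapsTo (fun s : ℝ ↦ b + -1 * s) (Icc 0 b) (Icc 0 b) := by
      intro s hs
      constructor <;> linarith [hs.1, hs.2]
    have hρ := hσ.comp_affine (Or.inr rfl) hmap
    have hρd : A.HasDirAt (fun s ↦ σ (b + -1 * s)) (Icc 0 b) 0 i ε := by
      rw [← hδε']
      exact HasDirAt.comp_affine (by rwa [mul_zero, add_zero]) hmap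
    have hm₁ : Icc 0 (min b p) ⊆ Icc 0 b := Icc_subset_Icc_right (min_le_left _ _)
    have hm₂ : Icc 0 (min b p) ⊆ Icc 0 p := Icc_subset_Icc_right (min_le_right _ _)
    have heq := (hρ.mono hm₁).eqOn (hτ.mono hm₂)
      (by simp only [mul_zero, add_zero, hσb, line_zero hz]) (hρd.mono hm₁) (hτd.mono hm₂)
    have heq' : σ (b + -1 * min b p) = A.line i z ε (min b p) :=
      heq (right_mem_Icc.2 (le_min hb hp0))
    -- Either `w` lies on the arc, which is truncated, or the whole arc cancels and the rest of the
    -- segment leads from `x` to `w`.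
    rcases le_total p b with hpb | hpb
    · rw [min_eq_right hpb, hτp] at heq'
      refine ⟨b - p, by linarith, by linarith, σ, ?_, rfl, ?_⟩
      · exact hσ.mono (Icc_subset_Icc_right (by linarith))
      · rw [← heq']
        congr 1
        ring
    · rw [min_eq_left hpb, show b + -1 * b = 0 by ring] at heq'
      refine ⟨p - b, by linarith, by linarith, fun s ↦ A.line i z ε (b + 1 * s), ?_, ?_, ?_⟩
      · apply hτ.comp_affine (Or.inl rfl)
        intro s hs
        constructor <;> linarith [hs.1, hs.2]
      · simp [heq']
      · simp only [show b + 1 * (p - b) = p by ring, hτp]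

/-! ### Chains of plaque segments, and finiteness of returns -/

/-- `Chain x p y`: a finite sequence of plaque segments of total length `p` joins `x` to `y`. -/
inductive Chain (A : LineAtlas N V ι) (x : N) : ℝ → N → Prop
  | refl : Chain A x 0 x
  | step {p : ℝ} {z w : N} (i : ι) (h : Chain A x p z) (hz : z ∈ A.core i) (hw : w ∈ A.core i)
      (h₂ : (A.chart i w).2 = (A.chart i z).2) :
      Chain A x (p + |(A.chart i w).1 - (A.chart i z).1|) w

/-- Backtracking between successive segments cancels, so the length can only drop. This is the
passage from chains, which have good compactness properties, to arcs, which are rigid. -/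
lemma Chain.exists_arcJoins [T2Space N] {x y : N} {p : ℝ} (h : A.Chain x p y) :
    ∃ b ≤ p, A.ArcJoins x b y := by
  induction h with
  | refl => exact ⟨0, le_rfl, arcJoins_refl x⟩
  | step i h hz hw h₂ ih =>
    obtain ⟨b, hb, hj⟩ := ih
    obtain ⟨b', hb', hj'⟩ := hj.step (A.core_subset i hz) (A.core_subset i hw) h₂
    exact ⟨b', hb'.trans (by gcongr), hj'⟩

/-- Short arcs that start near a given point stay in a plaque. -/
lemma exists_plaque_of_short_arc [T2Space N] {x : N} (hx : x ∈ (A.chart i).source) :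
    ∃ U ∈ 𝓝 x, ∃ c > 0, ∀ z ∈ U, ∀ w, ∀ b ≤ c, A.ArcJoins z b w →
      (A.chart i w).2 = (A.chart i z).2 := by
  have htgt : (A.chart i).target ∈ 𝓝 (A.chart i x) :=
    (A.chart i).open_target.mem_nhds ((A.chart i).map_source hx)
  obtain ⟨T, hT, W, hW, hTW⟩ := mem_nhds_prod_iff.1 htgt
  obtain ⟨r, hr, hrT⟩ := Metric.mem_nhds_iff.1 hT
  replace hrT : ball (A.chart i x).1 r ⊆ T := hrT
  have hcont := (A.chart i).continuousAt hx
  refine ⟨(A.chart i).source ∩ A.chart i ⁻¹' (ball (A.chart i x).1 (r / 2) ×ˢ W),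
    Filter.inter_mem ((A.chart i).open_source.mem_nhds hx) (hcont.preimage_mem_nhds
      (prod_mem_nhds (ball_mem_nhds _ (by positivity)) hW)), r / 3, by positivity, ?_⟩
  rintro z ⟨hz, hz₁, hz₂⟩ w b hbc ⟨hb, σ, hσ, hσ0, hσb⟩
  obtain ⟨ε, hε, hσd⟩ := hσ 0 (left_mem_Icc.2 hb) i (hσ0 ▸ hz)
  -- The start is within `r / 2` of the centre and the motion is at most `r / 3`, so the plaque
  -- segment stays in the box; uniqueness identifies it with the arc.
  have hI : ∀ s ∈ Icc 0 b, ((A.chart i z).1 + ε * s, (A.chart i z).2) ∈ (A.chart i).target := by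
    intro s hs
    refine hTW ⟨hrT ?_, hz₂⟩
    rw [Metric.mem_ball, Real.dist_eq, abs_lt] at hz₁ ⊢
    dsimp only
    rcases hε with rfl | rfl <;> constructor <;> linarith [hz₁.1, hz₁.2, hs.1, hs.2]
  have heq := hσ.eqOn (isArc_line hε hI) (by rw [hσ0, line_zero hz]) hσd
    (hasDirAt_line hI (left_mem_Icc.2 hb)) (right_mem_Icc.2 hb)
  rw [← hσb, heq, chart_line (hI b (right_mem_Icc.2 hb))]

/-- Only finitely many points of a small transversal near `x` are joined to `x` by arcs of bounded
length. -/
lemma finite_arcJoins [T2Space N] {X : Type*} {x : N} (hx : x ∈ (A.chart i).source) (ℓ : ℝ) :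
    ∃ U ∈ 𝓝 x, ∀ (φ : X → N) (W : Set X), MapsTo φ W U →
      InjOn (fun w ↦ (A.chart i (φ w)).2) W →
      {w ∈ W | ∃ b ≤ ℓ, A.ArcJoins x b (φ w)}.Finite := by
  obtain ⟨U, hU, c, hc, hcU⟩ := exists_plaque_of_short_arc hx
  refine ⟨U, hU, fun φ W hW hinj ↦ ?_⟩
  by_contra hinf
  have : Nonempty N := ⟨x⟩
  have hdata : ∀ w ∈ {w ∈ W | ∃ b ≤ ℓ, A.ArcJoins x b (φ w)}, ∃ q : ℝ × Bool × (ℝ → N),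
      0 ≤ q.1 ∧ q.1 ≤ ℓ ∧ A.IsArc q.2.2 (Icc 0 q.1) ∧ q.2.2 0 = x ∧ q.2.2 q.1 = φ w ∧
        A.HasDirAt q.2.2 (Icc 0 q.1) 0 i (if q.2.1 then 1 else -1) := by
    rintro w ⟨hw, b, hbℓ, hb, σ, hσ, hσ0, hσb⟩
    obtain ⟨ε, hε, hd⟩ := hσ 0 (left_mem_Icc.2 hb) i (hσ0 ▸ hx)
    rcases hε with rfl | rfl
    · exact ⟨⟨b, true, σ⟩, hb, hbℓ, hσ, hσ0, hσb, by simpa using hd⟩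
    · exact ⟨⟨b, false, σ⟩, hb, hbℓ, hσ, hσ0, hσb, by simpa using hd⟩
  choose! q hq0 hqℓ hqarc hqx hqφ hqd using hdata
  -- Pigeonhole: sort the points by initial direction and by length of the arc in steps of `c`.
  have hmaps : MapsTo (fun w ↦ ((⌊(q w).1 / c⌋₊, (q w).2.1) : ℕ × Bool))
      {w ∈ W | ∃ b ≤ ℓ, A.ArcJoins x b (φ w)} (Iic ⌊ℓ / c⌋₊ ×ˢ univ) := by
    intro w hw
    refine ⟨?_, mem_univ _⟩
    exact Nat.floor_le_floor (by gcongr; exact hqℓ w hw)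
  obtain ⟨w₁, hw₁, w₂, hw₂, hne, heq⟩ := Infinite.exists_ne_map_eq_of_mapsTo hinf hmaps
    ((finite_Iic _).prod finite_univ)
  rw [Prod.mk.injEq] at heq
  have habs : |(q w₁).1 - (q w₂).1| ≤ c := by
    have h₁ := Nat.floor_le (div_nonneg (hq0 w₁ hw₁) hc.le)
    have h₂ := Nat.lt_floor_add_one ((q w₁).1 / c)
    have h₃ := Nat.floor_le (div_nonneg (hq0 w₂ hw₂) hc.le)
    have h₄ := Nat.lt_floor_add_one ((q w₂).1 / c)
    rw [heq.1] at h₁ h₂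
    rw [div_lt_iff₀ hc] at h₂ h₄
    rw [le_div_iff₀ hc] at h₁ h₃
    rw [abs_le]
    constructor <;> linarith
  -- In one class the longer arc extends the shorter one, and the remainder is an arc of length at
  -- most `c` between the two points. They lie in the same plaque, hence coincide.
  have main : ∀ w₁ ∈ {w ∈ W | ∃ b ≤ ℓ, A.ArcJoins x b (φ w)},
      ∀ w₂ ∈ {w ∈ W | ∃ b ≤ ℓ, A.ArcJoins x b (φ w)}, (q w₁).2.1 = (q w₂).2.1 →
      (q w₁).1 ≤ (q w₂).1 → (q w₂).1 - (q w₁).1 ≤ c → w₁ = w₂ := by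
    intro w₁ hw₁ w₂ hw₂ hdir hle hlec
    have hsub : Icc 0 (q w₁).1 ⊆ Icc 0 (q w₂).1 := Icc_subset_Icc_right hle
    have hd₂ := hqd w₂ hw₂
    rw [← hdir] at hd₂
    have heq := (hqarc w₁ hw₁).eqOn ((hqarc w₂ hw₂).mono hsub) (by rw [hqx w₁ hw₁, hqx w₂ hw₂])
      (hqd w₁ hw₁) (hd₂.mono hsub) (right_mem_Icc.2 (hq0 w₁ hw₁))
    have hj : A.ArcJoins (φ w₁) ((q w₂).1 - (q w₁).1) (φ w₂) := by
      refine ⟨by linarith, fun s ↦ (q w₂).2.2 ((q w₁).1 + 1 * s), ?_, ?_, ?_⟩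
      · apply (hqarc w₂ hw₂).comp_affine (Or.inl rfl)
        intro s hs
        constructor <;> linarith [hs.1, hs.2, hq0 w₁ hw₁]
      · simp only [mul_zero, add_zero, ← heq, hqφ w₁ hw₁]
      · simp only [show (q w₁).1 + 1 * ((q w₂).1 - (q w₁).1) = (q w₂).1 by ring, hqφ w₂ hw₂]
    exact hinj hw₁.1 hw₂.1 (hcU _ (hW hw₁.1) _ _ hlec hj).symm
  rcases le_total (q w₁).1 (q w₂).1 with hle | hle
  · exact hne (main w₁ hw₁ w₂ hw₂ heq.2 hle (by linarith [(abs_le.1 habs).1]))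
  · exact hne (main w₂ hw₂ w₁ hw₁ heq.2.symm hle (by linarith [(abs_le.1 habs).2])).symm

end LineAtlas

/-! ### Compactness of chain relations and the measure argument -/

lemma IsCompact.setOf_eq {X Y : Type*} [TopologicalSpace X] [T2Space X] [TopologicalSpace Y]
    [T2Space Y] {K : Set X} (hK : IsCompact K) {f g : X → Y} (hf : ContinuousOn f K)
    (hg : ContinuousOn g K) : IsCompact {x ∈ K | f x = g x} :=
  hK.of_isClosed_subset
    ((hf.prodMk hg).preimage_isClosed_of_isClosed hK.isClosed isClosed_diagonal) fun _ h ↦ h.1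

namespace LineAtlas

variable {N V ι X : Type*} [TopologicalSpace N] [TopologicalSpace V] (A : LineAtlas N V ι)

/-- The triples `(w, y, p)` such that a chain of length `p` with itinerary `Q` joins `φ w`, `w ∈ K`,
to `y`. -/
def chainSet (φ : X → N) (K : Set X) : List ι → Set (X × N × ℝ)
  | [] => (fun w ↦ (w, φ w, 0)) '' K
  | i :: Q => (fun q : (X × N × ℝ) × N ↦
      (q.1.1, q.2, q.1.2.2 + |(A.chart i q.2).1 - (A.chart i q.1.2.1).1|)) ''
      {q ∈ (chainSet φ K Q ∩ {h | h.2.1 ∈ A.core i}) ×ˢ A.core i |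
        (A.chart i q.2).2 = (A.chart i q.1.2.1).2}

variable {A} {φ : X → N} {K : Set X}

/-- Adding a step imposes closed conditions on a product with a compact core, then takes a
continuous image. Cores are needed because a chart is continuous only on its domain. -/
lemma isCompact_chainSet [T2Space N] [T2Space V] [TopologicalSpace X] [T2Space X]
    (hK : IsCompact K) (hφ : ContinuousOn φ K) (Q : List ι) : IsCompact (A.chainSet φ K Q) := by
  induction Q with
  | nil => exact hK.image_of_continuousOn (by fun_prop)
  | cons i Q ih =>
    have h₁ : IsCompact ((A.chainSet φ K Q ∩ {h | h.2.1 ∈ A.core i}) ×ˢ A.core i) := by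
      refine (ih.inter_right ?_).prod (A.isCompact_core i)
      exact (A.isCompact_core i).isClosed.preimage (by fun_prop)
    have hc : ContinuousOn (A.chart i) (A.core i) :=
      (A.chart i).continuousOn.mono (A.core_subset i)
    have hc₁ : ContinuousOn (fun q : (X × N × ℝ) × N ↦ A.chart i q.2)
        ((A.chainSet φ K Q ∩ {h | h.2.1 ∈ A.core i}) ×ˢ A.core i) :=
      hc.comp (by fun_prop) fun q hq ↦ hq.2
    have hc₂ : ContinuousOn (fun q : (X × N × ℝ) × N ↦ A.chart i q.1.2.1)
        ((A.chainSet φ K Q ∩ {h | h.2.1 ∈ A.core i}) ×ˢ A.core i) :=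
      hc.comp (by fun_prop) fun q hq ↦ hq.1.2
    refine (h₁.setOf_eq hc₁.snd hc₂.snd).image_of_continuousOn ?_
    have hc₁' := hc₁.mono (sep_subset _ fun q ↦ (A.chart i q.2).2 = (A.chart i q.1.2.1).2)
    have hc₂' := hc₂.mono (sep_subset _ fun q ↦ (A.chart i q.2).2 = (A.chart i q.1.2.1).2)
    exact ContinuousOn.prodMk (by fun_prop) (ContinuousOn.prodMk (by fun_prop)
      (ContinuousOn.add (by fun_prop) (hc₁'.fst.sub hc₂'.fst).abs))

lemma Chain.exists_mem_chainSet {w : X} {p : ℝ} {y : N} (h : A.Chain (φ w) p y) (hw : w ∈ K) :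
    ∃ Q, (w, y, p) ∈ A.chainSet φ K Q := by
  induction h with
  | refl => exact ⟨[], w, hw, rfl⟩
  | @step p z z' i h hz hw' h₂ ih =>
    obtain ⟨Q, hQ⟩ := ih
    exact ⟨i :: Q, ⟨(w, z, p), z'⟩, ⟨⟨⟨hQ, hz⟩, hw'⟩, h₂⟩, rfl⟩

lemma chain_of_mem_chainSet {Q : List ι} {w : X} {p : ℝ} {y : N}
    (h : (w, y, p) ∈ A.chainSet φ K Q) : w ∈ K ∧ A.Chain (φ w) p y := by
  induction Q generalizing w p y with
  | nil =>
    obtain ⟨w', hw', h⟩ := h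
    simp only [Prod.mk.injEq] at h
    obtain ⟨rfl, rfl, rfl⟩ := h
    exact ⟨hw', .refl⟩
  | cons i Q ih =>
    obtain ⟨⟨⟨w', z, p'⟩, z'⟩, ⟨⟨⟨hQ, hz⟩, hw'⟩, h₂⟩, h⟩ := h
    simp only [Prod.mk.injEq] at h
    obtain ⟨rfl, rfl, rfl⟩ := h
    obtain ⟨hK, hch⟩ := ih hQ
    exact ⟨hK, .step i hch hz hw' h₂⟩

/-- A compact set of positive measure of a transversal contains a measurable set of positive measure
no two distinct points of which are joined by a chain of length at most `ℓ`. -/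
theorem exists_forall_not_chain [T2Space N] [T2Space V] [Countable ι] [MetricSpace X]
    [SecondCountableTopology X] [MeasurableSpace X] [BorelSpace X] {μ : Measure X}
    (hK : IsCompact K) (hφ : ContinuousOn φ K) (hμ : 0 < μ K) (ℓ : ℝ)
    (hloc : ∀ u ∈ K, ∃ i, φ u ∈ (A.chart i).source ∧
      ∃ W ∈ 𝓝[K] u, InjOn (fun w ↦ (A.chart i (φ w)).2) W) :
    ∃ B ⊆ K, MeasurableSet B ∧ 0 < μ B ∧
      ∀ w ∈ B, ∀ w' ∈ B, w ≠ w' → ∀ p ≤ ℓ, ¬ A.Chain (φ w) p (φ w') := by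
  -- `P Q` consists of the pairs in `K` related by a chain of itinerary `Q` and length at most `ℓ`.
  set P : List ι → Set (X × X) := fun Q ↦ (fun q : (X × N × ℝ) × X ↦ (q.1.1, q.2)) ''
    {q ∈ (A.chainSet φ K Q ∩ {h | h.2.2 ≤ ℓ}) ×ˢ K | q.1.2.1 = φ q.2} with hP
  have hPc : ∀ Q, IsCompact (P Q) := by
    intro Q
    have h₁ : IsCompact ((A.chainSet φ K Q ∩ {h | h.2.2 ≤ ℓ}) ×ˢ K) :=
      ((isCompact_chainSet hK hφ Q).inter_right
        (isClosed_le (by fun_prop) continuous_const)).prod hK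
    refine (h₁.setOf_eq (by fun_prop) ?_).image (by fun_prop)
    exact hφ.comp (by fun_prop) fun q hq ↦ hq.2
  have hPmem : ∀ w ∈ K, ∀ w' ∈ K, (∃ Q, (w, w') ∈ P Q) ↔ ∃ p ≤ ℓ, A.Chain (φ w) p (φ w') := by
    intro w hw w' hw'
    constructor
    · rintro ⟨Q, ⟨⟨u, y, p⟩, u'⟩, ⟨⟨⟨hQ, hpℓ⟩, -⟩, hy⟩, heq⟩
      simp only [Prod.mk.injEq] at heq hy
      obtain ⟨rfl, rfl⟩ := heq
      subst hy
      exact ⟨p, hpℓ, (chain_of_mem_chainSet hQ).2⟩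
    · rintro ⟨p, hpℓ, h⟩
      obtain ⟨Q, hQ⟩ := h.exists_mem_chainSet hw
      exact ⟨Q, ⟨(w, φ w', p), w'⟩, ⟨⟨⟨hQ, hpℓ⟩, hw'⟩, rfl⟩, rfl⟩
  have hPK : ∀ Q, ∀ x ∈ P Q, x.2 ∈ K := by
    rintro Q _ ⟨q, hq, rfl⟩
    exact hq.1.2
  -- `D m` collects the points related to a different point at distance at most `1 / (m + 1)`. The
  -- lower bounds `1 / (k + 1)` remove the diagonal by closed conditions, so `D m` is a countable
  -- union of compact sets.
  set D : ℕ → Set X := fun m ↦ ⋃ (Q : List ι) (k : ℕ), Prod.fst ''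
    (P Q ∩ {x | 1 / ((k : ℝ) + 1) ≤ dist x.1 x.2 ∧ dist x.1 x.2 ≤ 1 / ((m : ℝ) + 1)}) with hD
  have hDm : ∀ m, MeasurableSet (D m) := by
    intro m
    refine MeasurableSet.iUnion fun Q ↦ MeasurableSet.iUnion fun k ↦ ?_
    refine (((hPc Q).inter_right ?_).image continuous_fst).isClosed.measurableSet
    exact (isClosed_le continuous_const continuous_dist).inter
      (isClosed_le continuous_dist continuous_const)
  have hcover : K ⊆ ⋃ m, K \ D m := by
    intro u hu
    obtain ⟨i, hi, W, hW, hinj⟩ := hloc u hu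
    obtain ⟨U, hU, hfin⟩ := A.finite_arcJoins (X := X) hi ℓ
    have hW' : W ∩ φ ⁻¹' U ∈ 𝓝[K] u := Filter.inter_mem hW ((hφ u hu).preimage_mem_nhdsWithin hU)
    have hS := hfin φ (W ∩ φ ⁻¹' U) (fun w hw ↦ hw.2) (hinj.mono inter_subset_left)
    set S := {w ∈ W ∩ φ ⁻¹' U | ∃ b ≤ ℓ, A.ArcJoins (φ u) b (φ w)} with hSdef
    obtain ⟨r, hr, hrW⟩ := Metric.mem_nhdsWithin_iff.1 hW'
    -- Finitely many related points near `u` leave a ball around `u` free of all of them but `u`.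
    have hcompl : (S \ {u})ᶜ ∈ 𝓝 u :=
      (hS.subset sdiff_subset).isClosed.isOpen_compl.mem_nhds (by simp)
    obtain ⟨r', hr', hrS⟩ := Metric.mem_nhds_iff.1 hcompl
    obtain ⟨m, hm⟩ := exists_nat_one_div_lt (lt_min hr hr')
    refine mem_iUnion.2 ⟨m, hu, fun hmem ↦ ?_⟩
    simp only [hD, mem_iUnion] at hmem
    obtain ⟨Q, k, ⟨w, w'⟩, ⟨hQ, hk₁, hk₂⟩, rfl⟩ := hmem
    have hw' : w' ∈ K := hPK Q _ hQ
    dsimp only at *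
    have hdist : dist w' w < min r r' := by
      rw [dist_comm]
      exact hk₂.trans_lt hm
    have hne : w' ≠ w := by
      rintro rfl
      rw [dist_self] at hk₁
      exact absurd hk₁ (not_le.2 (by positivity))
    obtain ⟨p, hpℓ, hch⟩ := (hPmem w hu w' hw').1 ⟨Q, hQ⟩
    obtain ⟨b, hbp, hb⟩ := hch.exists_arcJoins
    refine hrS (mem_ball.2 (hdist.trans_le (min_le_right _ _))) ⟨⟨?_, b, hbp.trans hpℓ, hb⟩, hne⟩
    exact hrW ⟨mem_ball.2 (hdist.trans_le (min_le_left _ _)), hw'⟩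
  obtain ⟨m, hm⟩ : ∃ m, μ (K \ D m) ≠ 0 := by
    by_contra! h
    exact hμ.ne' (measure_mono_null hcover (measure_iUnion_null h))
  -- Around `x` every neighbourhood meets `K \ D m` in positive measure; half the radius `1 / (m +
  -- 1)` keeps any two points of the ball within that distance.
  obtain ⟨x, -, hx⟩ := exists_mem_forall_mem_nhdsWithin_pos_measure hm
  set r : ℝ := 1 / ((m : ℝ) + 1) / 2 with hr
  have hr0 : 0 < r := by positivity
  refine ⟨(K \ D m) ∩ ball x r, inter_subset_left.trans sdiff_subset,
    (hK.measurableSet.diff (hDm m)).inter measurableSet_ball,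
    hx _ (inter_mem_nhdsWithin _ (ball_mem_nhds x hr0)), ?_⟩
  rintro w ⟨⟨hw, hwD⟩, hwx⟩ w' ⟨⟨hw', -⟩, hwx'⟩ hne p hp hch
  obtain ⟨Q, hQ⟩ := (hPmem w hw w' hw').2 ⟨p, hp, hch⟩
  obtain ⟨k, hk⟩ := exists_nat_one_div_lt (dist_pos.2 hne)
  apply hwD
  simp only [hD, mem_iUnion]
  refine ⟨Q, k, ⟨w, w'⟩, ⟨hQ, hk.le, ?_⟩, rfl⟩
  have h₁ := dist_triangle_right w w' x
  have h₂ := mem_ball.1 hwx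
  have h₃ := mem_ball.1 hwx'
  have : 1 / ((m : ℝ) + 1) = r + r := by rw [hr]; ring
  dsimp only
  linarith

end LineAtlas

/-! ### Straightening by a primitive along the first coordinate -/

section Primitive

variable {V : Type*} [TopologicalSpace V] {g : ℝ × V → ℝ} {α β a : ℝ} {W : Set V}

/-- The substitution `s = a + (u - a) θ` moves the endpoint into the integrand, leaving a parametric
integral over `[0, 1]`. Clamping `θ` with `projIcc` makes the integrand continuous for all real `θ`.
-/
lemma continuousOn_primitive_left [FirstCountableTopology V] (ha : a ∈ Ioo α β)
    (hg : ContinuousOn g (Ioo α β ×ˢ W)) :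
    ContinuousOn (fun q : ℝ × V ↦ ∫ s in a..q.1, g (s, q.2)) (Ioo α β ×ˢ W) := by
  have hmem : ∀ q ∈ Ioo α β ×ˢ W, ∀ θ ∈ Icc (0 : ℝ) 1,
      ((a + (q.1 - a) * θ, q.2) : ℝ × V) ∈ Ioo α β ×ˢ W := by
    intro q hq θ hθ
    refine ⟨?_, hq.2⟩
    have := (convex_Ioo α β).add_smul_sub_mem ha hq.1 hθ
    rwa [smul_eq_mul, mul_comm] at this
  have hc : Continuous fun q : ↥(Ioo α β ×ˢ W) ↦ ∫ θ in (0 : ℝ)..1,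
      g (a + (q.1.1 - a) * (projIcc (0 : ℝ) 1 zero_le_one θ : ℝ), q.1.2) := by
    apply intervalIntegral.continuous_parametric_intervalIntegral_of_continuous'
    refine hg.comp_continuous (f := fun x : ↥(Ioo α β ×ˢ W) × ℝ ↦
      ((a + (x.1.1.1 - a) * (projIcc (0 : ℝ) 1 zero_le_one x.2 : ℝ), x.1.1.2) : ℝ × V)) ?_ ?_
    · have : Continuous fun x : ↥(Ioo α β ×ˢ W) × ℝ ↦ (projIcc (0 : ℝ) 1 zero_le_one x.2 : ℝ) :=
        continuous_subtype_val.comp (continuous_projIcc.comp continuous_snd)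
      fun_prop
    · exact fun x ↦ hmem x.1 x.1.2 _ (projIcc (0 : ℝ) 1 zero_le_one x.2).2
  rw [continuousOn_iff_continuous_domRestrict]
  have hc' : Continuous fun q : ↥(Ioo α β ×ˢ W) ↦ (q.1.1 - a) * ∫ θ in (0 : ℝ)..1,
      g (a + (q.1.1 - a) * (projIcc (0 : ℝ) 1 zero_le_one θ : ℝ), q.1.2) := by fun_prop
  convert hc' using 1
  ext q
  have : ∫ θ in (0 : ℝ)..1, g (a + (q.1.1 - a) * (projIcc (0 : ℝ) 1 zero_le_one θ : ℝ), q.1.2) =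
      ∫ θ in (0 : ℝ)..1, g (a + (q.1.1 - a) * θ, q.1.2) := by
    apply intervalIntegral.integral_congr
    intro θ hθ
    rw [uIcc_of_le zero_le_one] at hθ
    simp only [projIcc_of_mem zero_le_one hθ]
  rw [this, ← smul_eq_mul, intervalIntegral.smul_integral_comp_add_mul (fun s ↦ g (s, q.1.2))]
  simp

lemma hasDerivAt_primitive_left (ha : a ∈ Ioo α β) (hg : ContinuousOn g (Ioo α β ×ˢ W)) {v : V}
    (hv : v ∈ W) {u : ℝ} (hu : u ∈ Ioo α β) :
    HasDerivAt (fun u ↦ ∫ s in a..u, g (s, v)) (g (u, v)) u := by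
  have hc : ContinuousOn (fun s ↦ g (s, v)) (Ioo α β) :=
    hg.comp (by fun_prop) fun s hs ↦ ⟨hs, hv⟩
  apply intervalIntegral.integral_hasDerivAt_right
  · exact (hc.mono ((convex_Ioo α β).ordConnected.uIcc_subset ha hu)).intervalIntegrable
  · exact hc.stronglyMeasurableAtFilter isOpen_Ioo u hu
  · exact hc.continuousAt (isOpen_Ioo.mem_nhds hu)

lemma strictMonoOn_primitive_left (ha : a ∈ Ioo α β) (hg : ContinuousOn g (Ioo α β ×ˢ W))
    (hpos : ∀ q ∈ Ioo α β ×ˢ W, 0 < g q) {v : V} (hv : v ∈ W) :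
    StrictMonoOn (fun u ↦ ∫ s in a..u, g (s, v)) (Ioo α β) := by
  apply strictMonoOn_of_deriv_pos (convex_Ioo α β)
  · exact fun u hu ↦ (hasDerivAt_primitive_left ha hg hv hu).continuousAt.continuousWithinAt
  · intro u hu
    rw [interior_Ioo] at hu
    rw [(hasDerivAt_primitive_left ha hg hv hu).deriv]
    exact hpos _ ⟨hu, hv⟩

end Primitive

section Straighten

variable {V : Type*} {f : ℝ × V → ℝ} {α β : ℝ} {W : Set V}

lemma injOn_fst_of_strictMonoOn (hm : ∀ v ∈ W, StrictMonoOn (fun s ↦ f (s, v)) (Ioo α β)) :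
    InjOn (fun q : ℝ × V ↦ (f q, q.2)) (Ioo α β ×ˢ W) := by
  rintro ⟨s, v⟩ ⟨hs, hv⟩ ⟨s', v'⟩ ⟨hs', -⟩ h
  simp only [Prod.mk.injEq] at h
  obtain ⟨h, rfl⟩ := h
  exact congrArg (·, v) ((hm v hv).injOn hs hs' h)

variable [TopologicalSpace V]

/-- No derivative in `v` is available. Instead, `f (u - δ, v') < m₁` and `m₂ < f (u + δ, v')`
persist for `v'` near `v`, and the intermediate value theorem reaches every value between `m₁` and
`m₂`. -/
lemma isOpenMap_fst_of_strictMonoOn (hW : IsOpen W) (hf : ContinuousOn f (Ioo α β ×ˢ W))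
    (hm : ∀ v ∈ W, StrictMonoOn (fun s ↦ f (s, v)) (Ioo α β)) :
    IsOpenMap ((Ioo α β ×ˢ W).domRestrict fun q : ℝ × V ↦ (f q, q.2)) := by
  rw [isOpenMap_iff_nhds_le]
  rintro ⟨⟨u, v⟩, hu, hv⟩ S hS
  rw [Filter.mem_map, mem_nhds_subtype] at hS
  obtain ⟨T, hT, hTS⟩ := hS
  obtain ⟨T₁, hT₁, T₂, hT₂, hT₁₂⟩ := mem_nhds_prod_iff.1 hT
  dsimp only at hu hv hT₁ hT₂
  obtain ⟨δ, hδ, hball⟩ := Metric.nhds_basis_closedBall.mem_iff.1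
    (Filter.inter_mem hT₁ (isOpen_Ioo.mem_nhds hu))
  rw [Real.closedBall_eq_Icc] at hball
  have hl : u - δ ∈ Ioo α β := (hball ⟨le_rfl, by linarith⟩).2
  have hr : u + δ ∈ Ioo α β := (hball ⟨by linarith, le_rfl⟩).2
  have hfv : ∀ s ∈ Ioo α β, ContinuousAt (fun v ↦ f (s, v)) v := by
    intro s hs
    have : ContinuousOn (fun v ↦ f (s, v)) W := hf.comp (by fun_prop) fun v hv ↦ ⟨hs, hv⟩
    exact this.continuousAt (hW.mem_nhds hv)
  obtain ⟨m₁, hm₁, hm₁'⟩ := exists_between (hm v hv hl hu (by linarith))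
  obtain ⟨m₂, hm₂, hm₂'⟩ := exists_between (hm v hv hu hr (by linarith))
  have h₁ := (hfv _ hl).eventually (Iio_mem_nhds hm₁)
  have h₂ := (hfv _ hr).eventually (Ioi_mem_nhds hm₂')
  have hV : {v' | f (u - δ, v') < m₁ ∧ m₂ < f (u + δ, v')} ∩ (T₂ ∩ W) ∈ 𝓝 v :=
    Filter.inter_mem (h₁.and h₂) (Filter.inter_mem hT₂ (hW.mem_nhds hv))
  refine Filter.mem_of_superset (prod_mem_nhds (Ioo_mem_nhds hm₁' hm₂) hV) ?_
  rintro ⟨s, v'⟩ ⟨hs, ⟨hv₁, hv₂⟩, hvT, hvW⟩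
  dsimp only at hs hv₁ hv₂ hvT hvW
  have hcont : ContinuousOn (fun s ↦ f (s, v')) (Icc (u - δ) (u + δ)) :=
    hf.comp (by fun_prop) fun s hs ↦ ⟨(hball hs).2, hvW⟩
  obtain ⟨u', hu', heq⟩ := intermediate_value_Icc (by linarith) hcont
    ⟨(hv₁.trans hs.1).le, (hs.2.trans hv₂).le⟩
  have := @hTS ⟨(u', v'), (hball hu').2, hvW⟩ (hT₁₂ ⟨(hball hu').1, hvT⟩)
  simpa [heq] using this

/-- The change of coordinates `(s, v) ↦ (f (s, v), v)` for `f` strictly monotone in `s`. -/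
noncomputable def straighten [Nonempty V] (hW : IsOpen W) (hf : ContinuousOn f (Ioo α β ×ˢ W))
    (hm : ∀ v ∈ W, StrictMonoOn (fun s ↦ f (s, v)) (Ioo α β)) :
    OpenPartialHomeomorph (ℝ × V) (ℝ × V) :=
  OpenPartialHomeomorph.ofContinuousOpenRestrict
    ((injOn_fst_of_strictMonoOn hm).toPartialEquiv _ _)
    (hf.prodMk continuousOn_snd) (isOpenMap_fst_of_strictMonoOn hW hf hm) (isOpen_Ioo.prod hW)

variable [Nonempty V] (hW : IsOpen W) (hf : ContinuousOn f (Ioo α β ×ˢ W))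
    (hm : ∀ v ∈ W, StrictMonoOn (fun s ↦ f (s, v)) (Ioo α β))

@[simp]
lemma straighten_source : (straighten hW hf hm).source = Ioo α β ×ˢ W := rfl

lemma straighten_target :
    (straighten hW hf hm).target = (fun q : ℝ × V ↦ (f q, q.2)) '' (Ioo α β ×ˢ W) := rfl

lemma ordConnected_straighten_target (v : V) :
    OrdConnected {s | (s, v) ∈ (straighten hW hf hm).target} := by
  by_cases hv : v ∈ W
  · have : {s | (s, v) ∈ (straighten hW hf hm).target} = (fun s ↦ f (s, v)) '' Ioo α β := by
      ext s
      rw [straighten_target]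
      constructor
      · rintro ⟨⟨u, v'⟩, ⟨hu, -⟩, h⟩
        simp only [Prod.mk.injEq] at h
        obtain ⟨rfl, rfl⟩ := h
        exact ⟨u, hu, rfl⟩
      · rintro ⟨u, hu, rfl⟩
        exact ⟨(u, v), ⟨hu, hv⟩, rfl⟩
    rw [this]
    have hc : ContinuousOn (fun s ↦ f (s, v)) (Ioo α β) :=
      hf.comp (by fun_prop) fun s hs ↦ ⟨hs, hv⟩
    exact (isPreconnected_Ioo.image _ hc).ordConnected
  · have : {s | (s, v) ∈ (straighten hW hf hm).target} = ∅ := by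
      rw [eq_empty_iff_forall_notMem]
      rintro s ⟨⟨u, v'⟩, ⟨-, hv'⟩, h⟩
      simp only [Prod.mk.injEq] at h
      obtain ⟨-, rfl⟩ := h
      exact hv hv'
    rw [this]
    exact ordConnected_empty

end Straighten

/-- The identification of `ℝ^1 × ℝ^m` with `ℝ × ℝ^m`. -/
noncomputable def euclideanOneProd (m : ℕ) :
    (EuclideanSpace ℝ (Fin 1) × EuclideanSpace ℝ (Fin m)) ≃L[ℝ] ℝ × EuclideanSpace ℝ (Fin m) :=
  ((EuclideanSpace.equiv (Fin 1) ℝ).trans (ContinuousLinearEquiv.funUnique (Fin 1) ℝ ℝ)).prodCongr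
    (.refl ℝ _)

lemma image_euclideanOneProd_ball {m : ℕ} (a : EuclideanSpace ℝ (Fin 1)) (r : ℝ)
    (W : Set (EuclideanSpace ℝ (Fin m))) :
    euclideanOneProd m '' (ball a r ×ˢ W) = Ioo (a 0 - r) (a 0 + r) ×ˢ W := by
  have hball : ∀ u : EuclideanSpace ℝ (Fin 1), u ∈ ball a r ↔ u 0 ∈ Ioo (a 0 - r) (a 0 + r) := by
    intro u
    rw [← Real.ball_eq_Ioo, mem_ball, mem_ball, EuclideanSpace.dist_eq]
    simp
  ext q
  constructor
  · rintro ⟨q, ⟨h₁, h₂⟩, rfl⟩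
    exact ⟨(hball _).1 h₁, h₂⟩
  · rintro ⟨h₁, h₂⟩
    have hq := (euclideanOneProd m).apply_symm_apply q
    refine ⟨(euclideanOneProd m).symm q, ⟨(hball _).2 ?_, ?_⟩, hq⟩
    · rwa [← hq] at h₁
    · rwa [← hq] at h₂

/-! ### Foliation charts of rank one and the speed of their plaques -/

namespace AnalyticFoliation

variable {n : ℕ} {N : Type*} [TopologicalSpace N]
  {e e' : OpenPartialHomeomorph N (EuclideanSpace ℝ (Fin 1) × EuclideanSpace ℝ (Fin (n - 1)))}

/-- A foliation chart, read in `ℝ × ℝ^(n-1)`. -/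
noncomputable def flatChart
    (e : OpenPartialHomeomorph N (EuclideanSpace ℝ (Fin 1) × EuclideanSpace ℝ (Fin (n - 1)))) :
    OpenPartialHomeomorph N (ℝ × EuclideanSpace ℝ (Fin (n - 1))) :=
  e.transHomeomorph (euclideanOneProd (n - 1)).toHomeomorph

lemma flatChart_snd (z : N) : (flatChart e z).2 = (e z).2 := rfl

variable [ChartedSpace (EuclideanSpace ℝ (Fin n)) N] {F : AnalyticFoliation n 1 N}

lemma exists_flatChart_target_eq (he : e ∈ F.charts) :
    ∃ α β : ℝ, ∃ W : Set (EuclideanSpace ℝ (Fin (n - 1))), α < β ∧ IsOpen W ∧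
      (flatChart e).target = Ioo α β ×ˢ W := by
  obtain ⟨a, r, b, s, hr, hs, h⟩ := F.target_eq e he
  refine ⟨a 0 - r, a 0 + r, ball b s, by linarith, isOpen_ball, ?_⟩
  rw [← image_euclideanOneProd_ball, ← h]
  exact ((euclideanOneProd (n - 1)).toHomeomorph.toEquiv.image_eq_preimage_symm _).symm

lemma contMDiffOn_flatChart (he : e ∈ F.charts) :
    ContMDiffOn (𝓡 n) 𝓘(ℝ, ℝ × EuclideanSpace ℝ (Fin (n - 1))) 1 (flatChart e) e.source :=
  (euclideanOneProd (n - 1)).contDiff.contMDiff.comp_contMDiffOn ((F.contMDiffOn e he).of_le le_top)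

lemma contMDiffOn_flatChart_symm (he : e ∈ F.charts) :
    ContMDiffOn 𝓘(ℝ, ℝ × EuclideanSpace ℝ (Fin (n - 1))) (𝓡 n) 1 (flatChart e).symm
      (flatChart e).target :=
  ((F.contMDiffOn_symm e he).of_le le_top).comp
    (euclideanOneProd (n - 1)).symm.contDiff.contMDiff.contMDiffOn fun _ h ↦ h

lemma mdifferentiableAt_flatChart (he : e ∈ F.charts) {z : N} (hz : z ∈ e.source) :
    MDifferentiableAt (𝓡 n) 𝓘(ℝ, ℝ × EuclideanSpace ℝ (Fin (n - 1))) (flatChart e) z :=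
  ((contMDiffOn_flatChart he).contMDiffAt (e.open_source.mem_nhds hz)).mdifferentiableAt
    one_ne_zero

lemma mdifferentiableAt_flatChart_symm (he : e ∈ F.charts)
    {q : ℝ × EuclideanSpace ℝ (Fin (n - 1))} (hq : q ∈ (flatChart e).target) :
    MDifferentiableAt 𝓘(ℝ, ℝ × EuclideanSpace ℝ (Fin (n - 1))) (𝓡 n) (flatChart e).symm q :=
  ((contMDiffOn_flatChart_symm he).contMDiffAt
    ((flatChart e).open_target.mem_nhds hq)).mdifferentiableAt one_ne_zero

lemma mfderiv_flatChart_snd (he : e ∈ F.charts) {z : N} (hz : z ∈ e.source)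
    (v : TangentSpace (𝓡 n) z) :
    (mfderiv (𝓡 n) 𝓘(ℝ, ℝ × EuclideanSpace ℝ (Fin (n - 1))) (flatChart e) z v :
      ℝ × EuclideanSpace ℝ (Fin (n - 1))).2 =
    (mfderiv (𝓡 n) 𝓘(ℝ, EuclideanSpace ℝ (Fin 1) × EuclideanSpace ℝ (Fin (n - 1))) e z v :
      EuclideanSpace ℝ (Fin 1) × EuclideanSpace ℝ (Fin (n - 1))).2 := by
  have he' : MDifferentiableAt (𝓡 n)
      𝓘(ℝ, EuclideanSpace ℝ (Fin 1) × EuclideanSpace ℝ (Fin (n - 1))) e z :=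
    ((F.contMDiffOn e he).contMDiffAt (e.open_source.mem_nhds hz)).mdifferentiableAt (by simp)
  have h := mfderiv_comp z (euclideanOneProd (n - 1)).differentiableAt.mdifferentiableAt he'
  have h' : (flatChart e : N → _) = euclideanOneProd (n - 1) ∘ e := rfl
  rw [h', h, mfderiv_eq_fderiv, ContinuousLinearEquiv.fderiv]
  rfl

lemma flatChart_compatible (he : e ∈ F.charts) (he' : e' ∈ F.charts) {z : N} (hz : z ∈ e.source)
    (hz' : z ∈ e'.source) : ∀ᶠ w in 𝓝 z, (flatChart e w).2 = (flatChart e z).2 →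
      (flatChart e' w).2 = (flatChart e' z).2 := by
  obtain ⟨h₂, h⟩ := F.compatible e he e' he' z ⟨hz, hz'⟩
  filter_upwards [h] with w hw heq
  simp only [flatChart_snd] at heq ⊢
  rw [hw, heq, ← h.self_of_nhds]

lemma mfderiv_flatChart_comp_symm (he : e ∈ F.charts) {q : ℝ × EuclideanSpace ℝ (Fin (n - 1))}
    (hq : q ∈ (flatChart e).target) :
    (mfderiv (𝓡 n) 𝓘(ℝ, ℝ × EuclideanSpace ℝ (Fin (n - 1))) (flatChart e)
      ((flatChart e).symm q)).comp
      (mfderiv 𝓘(ℝ, ℝ × EuclideanSpace ℝ (Fin (n - 1))) (𝓡 n) (flatChart e).symm q) =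
      ContinuousLinearMap.id ℝ _ := by
  rw [← mfderiv_comp q (mdifferentiableAt_flatChart he ((flatChart e).map_target hq))
    (mdifferentiableAt_flatChart_symm he hq)]
  have : (flatChart e ∘ (flatChart e).symm) =ᶠ[𝓝 q] id := by
    filter_upwards [(flatChart e).open_target.mem_nhds hq] with q' hq'
    exact (flatChart e).right_inv hq'
  rw [this.mfderiv_eq, mfderiv_id]

lemma surjective_mfderiv_flatChart (he : e ∈ F.charts) {z : N} (hz : z ∈ e.source) :
    Function.Surjective
      (mfderiv (𝓡 n) 𝓘(ℝ, ℝ × EuclideanSpace ℝ (Fin (n - 1))) (flatChart e) z) := by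
  have h : Function.Surjective (mfderiv (𝓡 n) 𝓘(ℝ, ℝ × EuclideanSpace ℝ (Fin (n - 1)))
      (flatChart e) ((flatChart e).symm (flatChart e z))) := fun v ↦
    ⟨_, congrArg (fun L ↦ L v) (mfderiv_flatChart_comp_symm he ((flatChart e).map_source hz))⟩
  rwa [(flatChart e).left_inv hz] at h

variable [RiemannianBundle (fun x : N ↦ TangentSpace (𝓡 n) x)]

/-- The speed of the first coordinate curves of a foliation chart. -/
noncomputable def speed
    (e : OpenPartialHomeomorph N (EuclideanSpace ℝ (Fin 1) × EuclideanSpace ℝ (Fin (n - 1))))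
    (q : ℝ × EuclideanSpace ℝ (Fin (n - 1))) : ℝ :=
  ‖(mfderiv 𝓘(ℝ, ℝ × EuclideanSpace ℝ (Fin (n - 1))) (𝓡 n) (flatChart e).symm q
    ((1, 0) : ℝ × EuclideanSpace ℝ (Fin (n - 1))) :
      TangentSpace (𝓡 n) ((flatChart e).symm q))‖

lemma speed_pos (he : e ∈ F.charts) {q : ℝ × EuclideanSpace ℝ (Fin (n - 1))}
    (hq : q ∈ (flatChart e).target) : 0 < speed e q := by
  rw [speed, norm_pos_iff]
  intro h0
  have := congrArg (fun L ↦ L ((1, 0) : ℝ × EuclideanSpace ℝ (Fin (n - 1))))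
    (mfderiv_flatChart_comp_symm he hq)
  erw [ContinuousLinearMap.comp_apply, h0, map_zero] at this
  exact zero_ne_one (congrArg Prod.fst this)

/-- The velocity is the image of the constant field `(1, 0)` under the tangent map of a `C^1` map,
and a continuous metric has a continuous norm. -/
lemma continuousOn_speed [IsManifold (𝓡 n) ω N]
    [IsContMDiffRiemannianBundle (𝓡 n) ∞ (EuclideanSpace ℝ (Fin n))
      (fun x : N ↦ TangentSpace (𝓡 n) x)] (he : e ∈ F.charts) :
    ContinuousOn (speed e) (flatChart e).target := by
  have : IsManifold (𝓡 n) 1 N := .of_le (n := ω) le_top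
  have : IsContinuousRiemannianBundle (EuclideanSpace ℝ (Fin n))
      (fun x : N ↦ TangentSpace (𝓡 n) x) := by
    obtain ⟨g, hg, h⟩ := IsContMDiffRiemannianBundle.exists_contMDiff (IB := 𝓡 n) (n := ∞)
      (F := EuclideanSpace ℝ (Fin n)) (E := fun x : N ↦ TangentSpace (𝓡 n) x)
    exact ⟨g, hg.continuous, h⟩
  have h₁ := (contMDiffOn_flatChart_symm he).continuousOn_tangentMapWithin le_rfl
    (flatChart e).open_target.uniqueMDiffOn
  have h₂ : Continuous fun q : ℝ × EuclideanSpace ℝ (Fin (n - 1)) ↦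
      (⟨q, ((1, 0) : ℝ × EuclideanSpace ℝ (Fin (n - 1)))⟩ :
        TangentBundle 𝓘(ℝ, ℝ × EuclideanSpace ℝ (Fin (n - 1)))
          (ℝ × EuclideanSpace ℝ (Fin (n - 1)))) :=
    (tangentBundleModelSpaceHomeomorph
      𝓘(ℝ, ℝ × EuclideanSpace ℝ (Fin (n - 1)))).symm.continuous.comp
        (Continuous.prodMk_left ((1, 0) : ℝ × EuclideanSpace ℝ (Fin (n - 1))))
  have h₃ := h₁.comp h₂.continuousOn (s := (flatChart e).target) fun q hq ↦ hq
  have h₄ := h₃.inner_bundle h₃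
  refine h₄.sqrt.congr fun q hq ↦ ?_
  rw [speed, norm_eq_sqrt_real_inner, ← mfderivWithin_of_isOpen (flatChart e).open_target hq]

end AnalyticFoliation

/-! ### Charts by length along the plaques -/

namespace AnalyticFoliation

variable {n : ℕ} {N : Type*} [TopologicalSpace N] [ChartedSpace (EuclideanSpace ℝ (Fin n)) N]
  {F : AnalyticFoliation n 1 N}
  {e e' : OpenPartialHomeomorph N (EuclideanSpace ℝ (Fin 1) × EuclideanSpace ℝ (Fin (n - 1)))}
  [RiemannianBundle (fun x : N ↦ TangentSpace (𝓡 n) x)]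

/-- The norms live on the fibres over `γ t` and `γ' t`, equal only propositionally; the velocities
are compared in the common model space. -/
lemma norm_mfderivWithin_congr {γ γ' : ℝ → N} {s : Set ℝ} {t : ℝ} (h : γ =ᶠ[𝓝[s] t] γ')
    (ht : γ t = γ' t) :
    ‖(mfderivWithin 𝓘(ℝ, ℝ) (𝓡 n) γ s t (1 : ℝ) : TangentSpace (𝓡 n) (γ t))‖ =
      ‖(mfderivWithin 𝓘(ℝ, ℝ) (𝓡 n) γ' s t (1 : ℝ) : TangentSpace (𝓡 n) (γ' t))‖ := by
  have hbase : ∀ {x y : N}, x = y → ∀ (v : TangentSpace (𝓡 n) x) (w : TangentSpace (𝓡 n) y),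
      @Eq (EuclideanSpace ℝ (Fin n)) v w → ‖v‖ = ‖w‖ := by
    rintro x _ rfl v w h
    exact congrArg (fun v : TangentSpace (𝓡 n) x ↦ ‖v‖) h
  exact hbase ht _ _
    (congrArg (fun A ↦ A (1 : ℝ)) (h.mfderivWithin_eq (I := 𝓘(ℝ, ℝ)) (I' := 𝓡 n) ht))

/-- The norm of a velocity tangent to the plaques of a foliation chart. -/
lemma norm_mfderivWithin_eq (he : e ∈ F.charts) {γ : ℝ → N} {s : Set ℝ} {t c : ℝ}
    (hs : UniqueDiffWithinAt ℝ s t) (hγ : ContinuousWithinAt γ s t) (ht : γ t ∈ e.source)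
    (hc : HasDerivWithinAt (fun t ↦ flatChart e (γ t))
      ((c, 0) : ℝ × EuclideanSpace ℝ (Fin (n - 1))) s t) :
    ‖(mfderivWithin 𝓘(ℝ, ℝ) (𝓡 n) γ s t (1 : ℝ) : TangentSpace (𝓡 n) (γ t))‖ =
      |c| * speed e (flatChart e (γ t)) := by
  have hev : γ =ᶠ[𝓝[s] t] (flatChart e).symm ∘ fun t ↦ flatChart e (γ t) := by
    filter_upwards [hγ.preimage_mem_nhdsWithin (e.open_source.mem_nhds ht)] with t' ht'
    exact ((flatChart e).left_inv ht').symm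
  rw [norm_mfderivWithin_congr hev ((flatChart e).left_inv ht).symm]
  have hq : flatChart e (γ t) ∈ (flatChart e).target := (flatChart e).map_source ht
  have hcomp := mfderiv_comp_mfderivWithin t (mdifferentiableAt_flatChart_symm he hq)
    hc.differentiableWithinAt.mdifferentiableWithinAt
    (uniqueMDiffWithinAt_iff_uniqueDiffWithinAt.2 hs)
  have hval : (fderivWithin ℝ (fun t ↦ flatChart e (γ t)) s t) 1 =
      c • ((1, 0) : ℝ × EuclideanSpace ℝ (Fin (n - 1))) := by
    rw [fderivWithin_derivWithin, hc.derivWithin hs]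
    simp
  rw [hcomp, mfderivWithin_eq_fderivWithin]
  rw [speed, ← Real.norm_eq_abs, ← norm_smul]
  congr 1
  erw [ContinuousLinearMap.comp_apply, hval, map_smul]

/-- `φ` is obtained from the foliation chart `e` by taking the length along the plaques as first
coordinate. -/
structure IsLengthChart
    (e : OpenPartialHomeomorph N (EuclideanSpace ℝ (Fin 1) × EuclideanSpace ℝ (Fin (n - 1))))
    (φ : OpenPartialHomeomorph N (ℝ × EuclideanSpace ℝ (Fin (n - 1)))) : Prop where
  source_eq : φ.source = e.source
  snd_eq : ∀ z, (φ z).2 = (e z).2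
  ordConnected : ∀ v, OrdConnected {s | (s, v) ∈ φ.target}
  exists_length : ∃ L : ℝ × EuclideanSpace ℝ (Fin (n - 1)) → ℝ,
    (∀ z, (φ z).1 = L (flatChart e z)) ∧
      ∀ u v, (u, v) ∈ (flatChart e).target → HasDerivAt (fun u ↦ L (u, v)) (speed e (u, v)) u

/-- The speed is positive and continuous, so its primitive from the midpoint of each plaque is
strictly increasing and jointly continuous, and can serve as first coordinate. -/
lemma exists_isLengthChart [IsManifold (𝓡 n) ω N]
    [IsContMDiffRiemannianBundle (𝓡 n) ∞ (EuclideanSpace ℝ (Fin n))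
      (fun x : N ↦ TangentSpace (𝓡 n) x)] (he : e ∈ F.charts) :
    ∃ φ, IsLengthChart e φ := by
  obtain ⟨α, β, W, hαβ, hW, htgt⟩ := exists_flatChart_target_eq he
  have ha : (α + β) / 2 ∈ Ioo α β := ⟨by linarith, by linarith⟩
  have hg := continuousOn_speed he
  rw [htgt] at hg
  have hpos : ∀ q ∈ Ioo α β ×ˢ W, 0 < speed e q := fun q hq ↦ speed_pos he (htgt ▸ hq)
  have hf := continuousOn_primitive_left ha hg
  have hm : ∀ v ∈ W, StrictMonoOn (fun u ↦ ∫ s in (α + β) / 2..u, speed e (s, v)) (Ioo α β) :=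
    fun v hv ↦ strictMonoOn_primitive_left ha hg hpos hv
  refine ⟨(flatChart e).trans (straighten hW hf hm), ?_, fun z ↦ rfl, fun v ↦ ?_,
    fun q ↦ ∫ s in (α + β) / 2..q.1, speed e (s, q.2), fun z ↦ rfl, fun u v h ↦ ?_⟩
  · rw [OpenPartialHomeomorph.trans_source, straighten_source, ← htgt]
    exact inter_eq_left.2 fun z hz ↦ (flatChart e).map_source hz
  · rw [OpenPartialHomeomorph.trans_target, inter_eq_left.2]
    · exact ordConnected_straighten_target hW hf hm v
    · intro q hq
      rw [mem_preimage, htgt]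
      exact (straighten hW hf hm).map_target hq
  · rw [htgt] at h
    exact hasDerivAt_primitive_left ha hg h.2 h.1

/-- Both first coordinates measure length along the same plaque, so on it they differ by a
translation and possibly a reflection. -/
lemma IsLengthChart.compatible (he : e ∈ F.charts) (he' : e' ∈ F.charts)
    {φ φ' : OpenPartialHomeomorph N (ℝ × EuclideanSpace ℝ (Fin (n - 1)))}
    (hφ : IsLengthChart e φ) (hφ' : IsLengthChart e' φ') {z : N} (hz : z ∈ e.source)
    (hz' : z ∈ e'.source) :
    ∃ ε : ℝ, (ε = 1 ∨ ε = -1) ∧ ∀ᶠ w in 𝓝 z, (φ w).2 = (φ z).2 →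
      (φ' w).2 = (φ' z).2 ∧ (φ' w).1 = (φ' z).1 + ε * ((φ w).1 - (φ z).1) := by
  obtain ⟨L, hL, hLd⟩ := hφ.exists_length
  obtain ⟨L', hL', hLd'⟩ := hφ'.exists_length
  set s₀ := (flatChart e z).1 with hs₀
  set v₀ := (flatChart e z).2 with hv₀
  set v₀' := (flatChart e' z).2 with hv₀'
  have hq₀ : ((s₀, v₀) : ℝ × EuclideanSpace ℝ (Fin (n - 1))) ∈ (flatChart e).target :=
    (flatChart e).map_source hz
  set c : ℝ → N := fun s ↦ (flatChart e).symm (s, v₀) with hc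
  have hcz : c s₀ = z := (flatChart e).left_inv hz
  set p : ℝ → ℝ × EuclideanSpace ℝ (Fin (n - 1)) := fun s ↦ flatChart e' (c s) with hp
  have hline : Continuous fun s : ℝ ↦ ((s, v₀) : ℝ × EuclideanSpace ℝ (Fin (n - 1))) := by fun_prop
  have hcc : ContinuousAt c s₀ :=
    ContinuousAt.comp (g := (flatChart e).symm) ((flatChart e).continuousAt_symm hq₀)
      hline.continuousAt
  have hev : ∀ᶠ s in 𝓝 s₀, (s, v₀) ∈ (flatChart e).target ∧ c s ∈ e'.source ∧
      (p s).2 = v₀' := by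
    have h₁ := hline.continuousAt.eventually ((flatChart e).open_target.mem_nhds hq₀)
    have h₂ := hcc.eventually (e'.open_source.mem_nhds (hcz ▸ hz'))
    have h₃ := flatChart_compatible he he' hz hz'
    rw [← hcz] at h₃
    filter_upwards [h₁, h₂, hcc.eventually h₃] with s hs₁ hs₂ hs₃
    refine ⟨hs₁, hs₂, ?_⟩
    rw [hcz] at hs₃
    have : flatChart e (c s) = (s, v₀) := (flatChart e).right_inv hs₁
    exact hs₃ (show (flatChart e (c s)).2 = v₀ by rw [this])
  obtain ⟨δ, hδ, hB⟩ := Metric.eventually_nhds_iff_ball.1 hev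
  set B := ball s₀ δ with hBdef
  have hBo : IsOpen B := isOpen_ball
  have hs₀B : s₀ ∈ B := mem_ball_self hδ
  have hcd : ∀ s ∈ B, MDifferentiableAt 𝓘(ℝ, ℝ) (𝓡 n) c s := by
    intro s hs
    refine (mdifferentiableAt_flatChart_symm he (hB s hs).1).comp s ?_
    have : DifferentiableAt ℝ (fun s : ℝ ↦ ((s, v₀) : ℝ × EuclideanSpace ℝ (Fin (n - 1)))) s := by
      fun_prop
    exact this.mdifferentiableAt
  have hpd : ∀ s ∈ B, HasDerivAt p ((deriv (fun s ↦ (p s).1) s, 0) :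
      ℝ × EuclideanSpace ℝ (Fin (n - 1))) s := by
    intro s hs
    have hd : DifferentiableAt ℝ p s := by
      rw [← mdifferentiableAt_iff_differentiableAt]
      exact (mdifferentiableAt_flatChart he' (hB s hs).2.1).comp s (hcd s hs)
    have h₂ : HasDerivAt (fun s ↦ (p s).2) 0 s := by
      refine (hasDerivAt_const s v₀').congr_of_eventuallyEq ?_
      filter_upwards [hBo.mem_nhds hs] with s' hs' using (hB s' hs').2.2
    exact hd.fst.hasDerivAt.prodMk h₂
  have hpf : ∀ s ∈ B, HasDerivAt (fun s ↦ (p s).1) (deriv (fun s ↦ (p s).1) s) s :=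
    fun s hs ↦ (hpd s hs).differentiableAt.fst.hasDerivAt
  -- The norm of the velocity of the plaque curve `c`, computed in both charts.
  have hspeed : ∀ s ∈ B, speed e (s, v₀) = |deriv (fun s ↦ (p s).1) s| * speed e' (p s) := by
    intro s hs
    have hcs : ContinuousWithinAt c univ s := (hcd s hs).continuousAt.continuousWithinAt
    have h₁ := norm_mfderivWithin_eq he' uniqueDiffWithinAt_univ hcs (hB s hs).2.1
      (hpd s hs).hasDerivWithinAt
    have hright : flatChart e (c s) = (s, v₀) := (flatChart e).right_inv (hB s hs).1
    have hline' : HasDerivAt (fun s ↦ flatChart e (c s))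
        ((1, 0) : ℝ × EuclideanSpace ℝ (Fin (n - 1))) s := by
      refine ((hasDerivAt_id s).prodMk (hasDerivAt_const s v₀)).congr_of_eventuallyEq ?_
      filter_upwards [hBo.mem_nhds hs] with s' hs' using (flatChart e).right_inv (hB s' hs').1
    have h₂ := norm_mfderivWithin_eq he uniqueDiffWithinAt_univ hcs
      ((flatChart e).map_target (hB s hs).1) hline'.hasDerivWithinAt
    rw [h₁, hright, abs_one, one_mul] at h₂
    exact h₂.symm
  have hne : ∀ s ∈ B, deriv (fun s ↦ (p s).1) s ≠ 0 := by
    intro s hs h0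
    have := speed_pos he (hB s hs).1
    rw [hspeed s hs, h0] at this
    simp at this
  -- A derivative that never vanishes on an interval has constant sign, by Darboux.
  obtain ⟨ε, hε, hεp⟩ : ∃ ε : ℝ, (ε = 1 ∨ ε = -1) ∧
      ∀ s ∈ B, |deriv (fun s ↦ (p s).1) s| = ε * deriv (fun s ↦ (p s).1) s := by
    rcases hasDerivWithinAt_forall_lt_or_forall_gt_of_forall_ne (convex_ball s₀ δ)
      (fun s hs ↦ (hpf s hs).hasDerivWithinAt) hne with h | h
    · exact ⟨-1, Or.inr rfl, fun s hs ↦ by rw [abs_of_neg (h s hs)]; ring⟩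
    · exact ⟨1, Or.inl rfl, fun s hs ↦ by rw [abs_of_pos (h s hs)]; ring⟩
  have hd : ∀ s ∈ B, HasDerivAt (fun s ↦ L' (p s) - ε * L (s, v₀)) 0 s := by
    intro s hs
    have hps : p s = ((p s).1, v₀') := by rw [← (hB s hs).2.2]
    have hmem : ((p s).1, v₀') ∈ (flatChart e').target := by
      rw [← hps]
      exact (flatChart e').map_source (hB s hs).2.1
    have h₁ : HasDerivAt (fun s ↦ L' (p s)) (speed e' (p s) * deriv (fun s ↦ (p s).1) s) s := by
      have h := (hLd' _ _ hmem).comp s (hpf s hs)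
      rw [← hps] at h
      refine h.congr_of_eventuallyEq ?_
      filter_upwards [hBo.mem_nhds hs] with s' hs'
      simp only [Function.comp_apply]
      rw [← (hB s' hs').2.2]
    have h₂ := (hLd s v₀ (hB s hs).1).const_mul ε
    refine (h₁.sub h₂).congr_deriv ?_
    rw [hspeed s hs, hεp s hs]
    rcases hε with rfl | rfl <;> ring
  have hconst : ∀ s ∈ B, L' (p s) - ε * L (s, v₀) = L' (p s₀) - ε * L (s₀, v₀) := by
    intro s hs
    exact hBo.is_const_of_deriv_eq_zero (convex_ball s₀ δ).isPreconnected
      (fun s hs ↦ (hd s hs).differentiableAt.differentiableWithinAt)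
      (fun s hs ↦ (hd s hs).deriv) hs hs₀B
  refine ⟨ε, hε, ?_⟩
  have hcont : ContinuousAt (fun w ↦ (flatChart e w).1) z :=
    ((flatChart e).continuousAt hz).fst
  filter_upwards [e.open_source.mem_nhds hz, hcont.eventually (hBo.mem_nhds hs₀B)] with w hw hwB heq
  rw [hφ.snd_eq, hφ.snd_eq, ← flatChart_snd, ← flatChart_snd, ← hv₀] at heq
  have hcw : c (flatChart e w).1 = w := by
    rw [hc, ← heq]
    exact (flatChart e).left_inv hw
  have hpw : p (flatChart e w).1 = flatChart e' w := by rw [hp]; simp only [hcw]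
  have hpz : p s₀ = flatChart e' z := by rw [hp]; simp only [hcz]
  constructor
  · rw [hφ'.snd_eq, hφ'.snd_eq, ← flatChart_snd, ← flatChart_snd, ← hpw]
    exact (hB _ hwB).2.2
  · have h := hconst _ hwB
    rw [hpw, hpz, ← hL', ← hL'] at h
    have h₁ : L ((flatChart e w).1, v₀) = (φ w).1 := by rw [hL, ← heq]
    have h₂ : L (s₀, v₀) = (φ z).1 := by rw [hL]
    rw [h₁, h₂] at h
    linear_combination h

/-- A horizontal path in the domain of a foliation chart stays in a plaque, and is at least as long
as the plaque segment between its ends. -/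
lemma IsLengthChart.le_pathELength [IsManifold (𝓡 n) ω N]
    [IsContMDiffRiemannianBundle (𝓡 n) ∞ (EuclideanSpace ℝ (Fin n))
      (fun x : N ↦ TangentSpace (𝓡 n) x)] (he : e ∈ F.charts)
    {φ : OpenPartialHomeomorph N (ℝ × EuclideanSpace ℝ (Fin (n - 1)))} (hφ : IsLengthChart e φ)
    {γ : ℝ → N} {a b : ℝ} (hab : a ≤ b) (hγ : ContMDiffOn 𝓘(ℝ, ℝ) (𝓡 n) 1 γ (Icc a b))
    (hsrc : MapsTo γ (Icc a b) e.source)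
    (hhor : ∀ t ∈ Icc a b, (mfderivWithin 𝓘(ℝ, ℝ) (𝓡 n) γ (Icc a b) t (1 : ℝ) :
      TangentSpace (𝓡 n) (γ t)) ∈ F.tangentSpace (γ t)) :
    (φ (γ b)).2 = (φ (γ a)).2 ∧
      ENNReal.ofReal |(φ (γ b)).1 - (φ (γ a)).1| ≤ Manifold.pathELength (𝓡 n) γ a b := by
  rcases hab.eq_or_lt with rfl | hlt
  · simp
  obtain ⟨L, hL, hLd⟩ := hφ.exists_length
  set P : ℝ → ℝ × EuclideanSpace ℝ (Fin (n - 1)) := fun t ↦ flatChart e (γ t) with hP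
  have hPc : ContDiffOn ℝ 1 P (Icc a b) := by
    rw [← contMDiffOn_iff_contDiffOn]
    exact (contMDiffOn_flatChart he).comp hγ hsrc
  have huniq := uniqueDiffOn_Icc hlt
  have hPd : ∀ t ∈ Icc a b, HasDerivWithinAt P (derivWithin P (Icc a b) t) (Icc a b) t :=
    fun t ht ↦ (hPc.differentiableOn one_ne_zero t ht).hasDerivWithinAt
  have hsnd : ∀ t ∈ Icc a b, (derivWithin P (Icc a b) t).2 = 0 := by
    intro t htI
    have h := hhor t htI e he (hsrc htI)
    rw [← mfderiv_flatChart_snd he (hsrc htI)] at h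
    have hcomp := mfderiv_comp_mfderivWithin t (mdifferentiableAt_flatChart he (hsrc htI))
      (hγ.mdifferentiableOn one_ne_zero t htI)
      (uniqueMDiffWithinAt_iff_uniqueDiffWithinAt.2 (huniq t htI))
    rw [mfderivWithin_eq_fderivWithin] at hcomp
    have h' := congrArg (fun A ↦ A (1 : ℝ)) hcomp
    rw [← fderivWithin_derivWithin]
    refine Eq.trans ?_ h
    exact congrArg Prod.snd h'
  have hconst : ∀ t ∈ Icc a b, (P t).2 = (P a).2 := by
    refine constant_of_derivWithin_zero (f := fun t ↦ (P t).2)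
      (hPc.differentiableOn one_ne_zero).snd fun t ht ↦ ?_
    have htI := Ico_subset_Icc_self ht
    have h : HasDerivWithinAt (fun t ↦ (P t).2) (derivWithin P (Icc a b) t).2 (Icc a b) t :=
      (hPd t htI).snd
    rw [h.derivWithin (huniq t htI), hsnd t htI]
  set v := (P a).2 with hv
  have hmem : ∀ t ∈ Icc a b, ((P t).1, v) ∈ (flatChart e).target := by
    intro t ht
    rw [← hconst t ht]
    exact (flatChart e).map_source (hsrc ht)
  -- On a plaque the length coordinate is `C^1` because its derivative, the speed, is continuous.
  have hLc : ContDiffOn ℝ 1 (fun u ↦ L (u, v)) {u | (u, v) ∈ (flatChart e).target} := by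
    have hline : Continuous fun u : ℝ ↦ ((u, v) : ℝ × EuclideanSpace ℝ (Fin (n - 1))) := by
      fun_prop
    have ho : IsOpen {u : ℝ | (u, v) ∈ (flatChart e).target} :=
      (flatChart e).open_target.preimage hline
    rw [show (1 : ℕ∞ω) = 0 + 1 by simp, contDiffOn_succ_iff_deriv_of_isOpen ho]
    refine ⟨fun u hu ↦ (hLd u v hu).differentiableAt.differentiableWithinAt, by simp, ?_⟩
    rw [contDiffOn_zero]
    refine ContinuousOn.congr (f := fun u ↦ speed e (u, v)) ?_ fun u hu ↦ (hLd u v hu).deriv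
    exact (continuousOn_speed he).comp hline.continuousOn fun u hu ↦ hu
  have hhc : ContDiffOn ℝ 1 (fun t ↦ L ((P t).1, v)) (Icc a b) := hLc.comp hPc.fst hmem
  have hφL : ∀ t ∈ Icc a b, (φ (γ t)).1 = L ((P t).1, v) := by
    intro t ht
    rw [hL, ← hconst t ht]
  constructor
  · rw [hφ.snd_eq, hφ.snd_eq]
    exact hconst b (right_mem_Icc.2 hab)
  rw [hφL b (right_mem_Icc.2 hab), hφL a (left_mem_Icc.2 hab), ← Real.norm_eq_abs,
    ofReal_norm]
  -- The variation of the length coordinate is at most the integral of the absolute value of its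
  -- derivative, and that integrand is the norm of the velocity of `γ`.
  refine (enorm_sub_le_lintegral_derivWithin_Icc_of_contDiffOn_Icc hhc hab).trans_eq ?_
  rw [Manifold.pathELength_eq_lintegral_mfderivWithin_Icc, ← restrict_Ioo_eq_restrict_Icc]
  refine setLIntegral_congr_fun measurableSet_Ioo fun t ht ↦ ?_
  have htI := Ioo_subset_Icc_self ht
  have hder : derivWithin P (Icc a b) t = ((derivWithin P (Icc a b) t).1, 0) := by
    rw [← hsnd t htI]
  have h₁ := hPd t htI
  rw [hder] at h₁
  have hPt : ((P t).1, v) = P t := by rw [← hconst t htI]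
  have h₂ := (hLd _ _ (hmem t htI)).comp_hasDerivWithinAt t h₁.fst
  rw [hPt] at h₂
  have h₃ := norm_mfderivWithin_eq he (huniq t htI) (hγ.continuousOn t htI) (hsrc htI) h₁
  have h₄ : ‖derivWithin (fun t ↦ L ((P t).1, v)) (Icc a b) t‖ =
      |(derivWithin P (Icc a b) t).1| * speed e (P t) := by
    have : derivWithin (fun t ↦ L ((P t).1, v)) (Icc a b) t = _ := h₂.derivWithin (huniq t htI)
    rw [this, norm_mul, mul_comm, Real.norm_eq_abs, Real.norm_eq_abs,
      abs_of_pos (speed_pos he ((flatChart e).map_source (hsrc htI)))]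
  rw [← ofReal_norm, ← ofReal_norm]
  exact congrArg ENNReal.ofReal (h₄.trans h₃.symm)

end AnalyticFoliation

/-! ### Transversals, the line atlas of a foliation, and chains from paths -/

namespace AnalyticFoliation

variable {n : ℕ} {N : Type*} [TopologicalSpace N] [ChartedSpace (EuclideanSpace ℝ (Fin n)) N]
  {F : AnalyticFoliation n 1 N}
  {e : OpenPartialHomeomorph N (EuclideanSpace ℝ (Fin 1) × EuclideanSpace ℝ (Fin (n - 1)))}

/-- The transverse coordinate kills vectors tangent to the leaves, so transversality makes its
derivative along the section surjective. Dimensions agree, and the inverse function theorem applies.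
-/
lemma TransverseSection.exists_injOn {p : N} (S : F.TransverseSection p) (he : e ∈ F.charts)
    {u : EuclideanSpace ℝ (Fin (n - 1))} (hu : u ∈ ball 0 1) (hz : S.param u ∈ e.source) :
    ∃ W ∈ 𝓝 u, InjOn (fun w ↦ (e (S.param w)).2) W := by
  set H : EuclideanSpace ℝ (Fin (n - 1)) → ℝ × EuclideanSpace ℝ (Fin (n - 1)) :=
    fun w ↦ flatChart e (S.param w) with hH
  have hS : ContMDiffAt (𝓡 (n - 1)) (𝓡 n) 1 S.param u :=
    (S.contMDiffOn.contMDiffAt (isOpen_ball.mem_nhds hu)).of_le (by simp)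
  have hHc : ContDiffAt ℝ 1 H u := by
    rw [← contMDiffAt_iff_contDiffAt]
    exact ((contMDiffOn_flatChart he).contMDiffAt (e.open_source.mem_nhds hz)).comp u hS
  have hGc : ContDiffAt ℝ 1 (fun w ↦ (H w).2) u := hHc.snd
  have hHd := (hHc.differentiableAt one_ne_zero).hasFDerivAt
  have hG := hHd.snd
  set T := (ContinuousLinearMap.snd ℝ ℝ (EuclideanSpace ℝ (Fin (n - 1)))).comp (fderiv ℝ H u)
    with hT
  have hcomp := mfderiv_comp u (mdifferentiableAt_flatChart he hz)
    (hS.mdifferentiableAt one_ne_zero)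
  have hsurj : Function.Surjective T := by
    intro y
    obtain ⟨v, hv⟩ := surjective_mfderiv_flatChart he hz
      ((0, y) : ℝ × EuclideanSpace ℝ (Fin (n - 1)))
    have hmem : v ∈ (mfderiv (𝓡 (n - 1)) (𝓡 n) S.param u).range ⊔ F.tangentSpace (S.param u) := by
      rw [S.transverse u hu]
      trivial
    obtain ⟨_, ⟨a, rfl⟩, b, hb, rfl⟩ := Submodule.mem_sup.1 hmem
    refine ⟨a, ?_⟩
    have hb' := hb e he hz
    rw [← mfderiv_flatChart_snd he hz] at hb'
    rw [map_add] at hv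
    have h₁ : T a = (mfderiv (𝓡 n) 𝓘(ℝ, ℝ × EuclideanSpace ℝ (Fin (n - 1))) (flatChart e)
        (S.param u) (mfderiv (𝓡 (n - 1)) (𝓡 n) S.param u a) :
          ℝ × EuclideanSpace ℝ (Fin (n - 1))).2 := by
      have h := congrArg (fun L ↦ L a) hcomp
      rw [mfderiv_eq_fderiv] at h
      exact congrArg Prod.snd h
    have h₂ := congrArg Prod.snd hv
    rw [h₁]
    refine Eq.trans ?_ h₂
    refine (add_zero _).symm.trans ?_
    rw [← hb']
    rfl
  have hinj : Function.Injective T := LinearMap.injective_iff_surjective.2 hsurj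
  set T' := ContinuousLinearEquiv.ofBijective T (LinearMap.ker_eq_bot.2 hinj)
    (LinearMap.range_eq_top.2 hsurj) with hT'
  have hstrict : HasStrictFDerivAt (fun w ↦ (H w).2)
      (T' : EuclideanSpace ℝ (Fin (n - 1)) →L[ℝ] EuclideanSpace ℝ (Fin (n - 1))) u := by
    apply hGc.hasStrictFDerivAt' _ one_ne_zero
    exact hG
  exact ⟨_, (hstrict.toOpenPartialHomeomorph _).open_source.mem_nhds
    hstrict.mem_toOpenPartialHomeomorph_source, (hstrict.toOpenPartialHomeomorph _).injOn⟩

variable [RiemannianBundle (fun x : N ↦ TangentSpace (𝓡 n) x)] [IsManifold (𝓡 n) ω N]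
  [IsContMDiffRiemannianBundle (𝓡 n) ∞ (EuclideanSpace ℝ (Fin n))
    (fun x : N ↦ TangentSpace (𝓡 n) x)]

variable (F) in
-- Second countability extracts a countable family whose cores still have interiors covering `N`;
-- countability is what makes the itineraries countable.
lemma exists_lineAtlas [SecondCountableTopology N] :
    ∃ t : Set N, t.Countable ∧ ∃ A : LineAtlas N (EuclideanSpace ℝ (Fin (n - 1))) t,
      ∀ i, ∃ e ∈ F.charts, IsLengthChart e (A.chart i) := by
  have : LocallyCompactSpace N := ChartedSpace.locallyCompactSpace (EuclideanSpace ℝ (Fin n)) N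
  have h : ∀ z : N, ∃ e ∈ F.charts, ∃ φ, IsLengthChart e φ ∧ ∃ K ∈ 𝓝 z, K ⊆ e.source ∧
      IsCompact K := by
    intro z
    obtain ⟨e, he, hz⟩ := F.exists_chart z
    obtain ⟨φ, hφ⟩ := exists_isLengthChart he
    exact ⟨e, he, φ, hφ, local_compact_nhds (e.open_source.mem_nhds hz)⟩
  choose e he φ hφ K hK hKe hKc using h
  obtain ⟨t, ht, hcover⟩ := TopologicalSpace.countable_cover_nhds
    fun z ↦ interior_mem_nhds.2 (hK z)
  refine ⟨t, ht, ⟨fun i ↦ φ i, fun i ↦ K i, fun i ↦ hKc i, fun i ↦ ?_, fun z ↦ ?_,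
    fun i ↦ (hφ i).ordConnected, fun i j z hz hz' ↦ ?_⟩, fun i ↦ ⟨e i, he i, hφ i⟩⟩
  · rw [(hφ i).source_eq]
    exact hKe i
  · have hz : z ∈ ⋃ x ∈ t, interior (K x) := hcover ▸ mem_univ z
    simp only [mem_iUnion] at hz
    obtain ⟨x, hx, hz⟩ := hz
    exact ⟨⟨x, hx⟩, mem_interior_iff_mem_nhds.1 hz⟩
  · rw [(hφ _).source_eq] at hz hz'
    exact (hφ i).compatible (he i) (he j) (hφ j) hz hz'

/-- A fine subdivision puts each piece of the path in one core, where it follows a plaque and is at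
least as long as the segment between its ends; lengths add up. -/
lemma Related.exists_chain {ι : Type*} {A : LineAtlas N (EuclideanSpace ℝ (Fin (n - 1))) ι}
    (hA : ∀ i, ∃ e ∈ F.charts, IsLengthChart e (A.chart i)) {ℓ : ℝ} (hℓ : 0 ≤ ℓ) {x y : N}
    (h : F.Related ℓ x y) : ∃ p ≤ ℓ, A.Chain x p y := by
  obtain ⟨γ, hγ, hhor, hlen, rfl, rfl⟩ := h
  have hγ₁ : ContMDiffOn 𝓘(ℝ, ℝ) (𝓡 n) 1 γ (Icc 0 1) := hγ.of_le (by simp)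
  have hγc : Continuous fun t : Icc (0 : ℝ) 1 ↦ γ t :=
    continuousOn_iff_continuous_domRestrict.1 hγ.continuousOn
  obtain ⟨t, ht0, htm, ⟨m, hm⟩, ht⟩ := exists_monotone_Icc_subset_open_cover_Icc
    (zero_le_one (α := ℝ)) (c := fun i ↦ (fun t : Icc (0 : ℝ) 1 ↦ γ t) ⁻¹' interior (A.core i))
    (fun i ↦ isOpen_interior.preimage hγc) (by
      intro s _
      obtain ⟨i, hi⟩ := A.exists_core_mem_nhds (γ s)
      exact mem_iUnion.2 ⟨i, mem_interior_iff_mem_nhds.2 hi⟩)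
  have key : ∀ k, ∃ p, 0 ≤ p ∧ A.Chain (γ 0) p (γ (t k)) ∧
      ENNReal.ofReal p ≤ Manifold.pathELength (𝓡 n) γ 0 (t k) := by
    intro k
    induction k with
    | zero =>
      rw [ht0]
      exact ⟨0, le_rfl, .refl, by simp⟩
    | succ k ih =>
      obtain ⟨p, hp, hch, hpl⟩ := ih
      obtain ⟨i, hi⟩ := ht k
      obtain ⟨e, he, hφ⟩ := hA i
      have hle : (t k : ℝ) ≤ t (k + 1) := htm k.le_succ
      have hsub : Icc (t k : ℝ) (t (k + 1)) ⊆ Icc 0 1 :=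
        Icc_subset_Icc (t k).2.1 (t (k + 1)).2.2
      have hcore : ∀ s ∈ Icc (t k : ℝ) (t (k + 1)), γ s ∈ A.core i := by
        intro s hs
        have : (⟨s, hsub hs⟩ : Icc (0 : ℝ) 1) ∈ Icc (t k) (t (k + 1)) := hs
        exact interior_subset (hi this)
      -- Repeated subdivision points are skipped: derivatives within a one-point interval are not
      -- unique.
      rcases hle.eq_or_lt with heq | hlt
      · rw [← heq]
        exact ⟨p, hp, hch, hpl⟩
      obtain ⟨h₁, h₂⟩ := hφ.le_pathELength he hle (hγ₁.mono hsub)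
        (fun s hs ↦ hφ.source_eq ▸ A.core_subset i (hcore s hs)) (by
          intro s hs
          rw [(hγ₁.mdifferentiableOn one_ne_zero s (hsub hs)).mfderivWithin_mono
            (uniqueMDiffWithinAt_iff_uniqueDiffWithinAt.2 (uniqueDiffOn_Icc hlt s hs)) hsub]
          exact hhor s (hsub hs))
      refine ⟨_, by positivity, hch.step i (hcore _ (left_mem_Icc.2 hle))
        (hcore _ (right_mem_Icc.2 hle)) h₁, ?_⟩
      rw [ENNReal.ofReal_add hp (abs_nonneg _), ← Manifold.pathELength_add (t k).2.1 hle]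
      exact add_le_add hpl h₂
  obtain ⟨p, hp, hch, hpl⟩ := key m
  rw [hm m le_rfl] at hch hpl
  exact ⟨p, (ENNReal.ofReal_le_ofReal_iff hℓ).1 (hpl.trans hlen), hch⟩

end AnalyticFoliation

/-! ### Rank one foliations are splittable -/

theorem mainTheorem12 (n : ℕ) (hn : 2 ≤ n)
    (N : Type*) [TopologicalSpace N] [T2Space N] [SecondCountableTopology N]
    [ChartedSpace (EuclideanSpace ℝ (Fin n)) N] [IsManifold (𝓡 n) ω N]
    [RiemannianBundle (fun x : N ↦ TangentSpace (𝓡 n) x)]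
    [IsContMDiffRiemannianBundle (𝓡 n) ∞ (EuclideanSpace ℝ (Fin n))
      (fun x : N ↦ TangentSpace (𝓡 n) x)]
    (F : AnalyticFoliation n 1 N) :
    F.IsSplittable := by
  intro p S ℓ hℓ E hE hEm hEpos
  obtain ⟨t, ht, A, hA⟩ := F.exists_lineAtlas
  have : Countable t := ht
  -- A Lebesgue measurable set contains a Borel set of the same measure, and inner regularity gives
  -- a compact set of positive measure inside it.
  obtain ⟨E', hE'E, hE'm, hE'ae⟩ := hEm.exists_measurable_subset_ae_eq
  have hE'pos : 0 < volume E' := by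
    rw [measure_congr hE'ae]
    exact hEpos
  obtain ⟨K, hKE', hK, hKpos⟩ := hE'm.exists_lt_isCompact hE'pos
  have hKE : K ⊆ S.preimage E := hKE'.trans hE'E
  have hKball : K ⊆ ball 0 1 := fun u hu ↦ (hKE hu).1
  obtain ⟨B, hBK, hBm, hBpos, hB⟩ := LineAtlas.exists_forall_not_chain (A := A) (φ := S.param)
    hK (S.contMDiffOn.continuousOn.mono hKball) hKpos ℓ (by
      intro u hu
      obtain ⟨i, hi⟩ := A.exists_mem_source (S.param u)
      obtain ⟨e, he, hφ⟩ := hA i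
      obtain ⟨W, hW, hinj⟩ := S.exists_injOn he (hKball hu) (hφ.source_eq ▸ hi)
      refine ⟨i, hi, W, mem_nhdsWithin_of_mem_nhds hW, ?_⟩
      simpa only [hφ.snd_eq] using hinj)
  -- Injectivity of the parametrization on the disc brings no further points into the trace.
  have hpre : S.preimage (S.param '' B) = B := by
    apply Subset.antisymm
    · rintro u ⟨hu, w, hw, hwu⟩
      have := @S.isEmbedding.injective ⟨w, hKball (hBK hw)⟩ ⟨u, hu⟩ hwu
      rw [Subtype.mk.injEq] at this
      exact this ▸ hw
    · exact fun u hu ↦ ⟨hKball (hBK hu), mem_image_of_mem _ hu⟩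
  refine ⟨S.param '' B, ?_, ?_, ?_, ?_⟩
  · rintro _ ⟨u, hu, rfl⟩
    exact (hKE (hBK hu)).2
  · rw [AnalyticFoliation.TransverseSection.LebesgueMeasurable, hpre]
    exact hBm.nullMeasurableSet
  · rwa [AnalyticFoliation.TransverseSection.lebesgue, hpre]
  · rintro _ ⟨w, hw, rfl⟩ _ ⟨w', hw', rfl⟩ hne hrel
    obtain ⟨q, hq, hch⟩ := hrel.exists_chain hA hℓ.le
    exact hB w hw w' hw' (fun h ↦ hne (h ▸ rfl)) q hq hch
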